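/- A group is called left-orderable if it is nontrivial and admits a strict total order $<$ such that $g<h$ implies $kg<kh$ for all $g,h,k$. A Heegaard diagram of genus $g\ge 0$ is a triple $\mathcal H=(\Sigma,\boldsymbol\alpha,\boldsymbol\beta)$, where $\Sigma$ is a closed, connected, oriented surface of genus $g$, where $\boldsymbol\alpha=(\alpha_1,\dots,\alpha_g)$ and $\boldsymbol\beta=(\beta_1,\dots,\beta_g)$ are each $g$-tuples of pairwise disjoint (smooth) simple closed curves on $\Sigma$ that are linearly independent in $H_1(\Sigma;\mathbb Z)$, and where each $\alpha_i$ is transverse to each $\beta_j$. It is a Heegaard diagram for the closed 3-manifold $Y$ if $Y$ has a handle decomposition with one 0-handle, $g$ 1-handles, $g$ 2-handles and one 3-handle such that $\Sigma$ is the boundary of the union of the 0- and 1-handles, the $\alpha_i$ are the belt circles of the 1-handles, and the $\beta_j$ are the attaching circles of the 2-handles. Let $\widehat{CF}(\mathcal H)$ be the free abelian group generated by the points of $\mathbb T_\alpha\cap\mathbb T_\beta\subset \mathrm{Sym}^g(\Sigma)$, i.e. by the tuples $(x_1,\dots,x_g)$ for which there is a permutation $\sigma\in S_g$ with $x_i\in\alpha_i\cap\beta_{\sigma(i)}$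 for all $i$. A closed, connected 3-manifold $Y$ is called a strong L-space if $H_1(Y;\mathbb Z)$ is finite and $Y$ has a Heegaard diagram $\mathcal H$ with $\widehat{CF}(\mathcal H)\cong\mathbb Z^{|H_1(Y;\mathbb Z)|}$. Theorem. If $Y$ is a strong L-space, then $\pi_1(Y)$ is not left-orderable. -/

import Mathlib

open scoped Manifold ContDiff

universe u

noncomputable section

/-- A group is left-orderable if it is nontrivial and carries a strict total order that is
invariant under left multiplication. -/
def LeftOrderable (G : Type*) [Group G] : Prop :=
  Nontrivial G ∧ ∃ lt : G → G → Prop, IsStrictTotalOrder G lt ∧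
    ∀ g h k : G, lt g h → lt (k * g) (k * h)

/-- The first singular homology group `H₁(X; ℤ)`. -/
abbrev SingularH1 (X : Type u) [TopologicalSpace X] : ModuleCat.{u} ℤ :=
  ((AlgebraicTopology.singularHomologyFunctor (ModuleCat.{u} ℤ) 1).obj
    (ModuleCat.of ℤ (ULift.{u} ℤ))).obj (TopCat.of X)

/-- The homomorphism `H₁(X; ℤ) → H₁(X'; ℤ)` induced by a continuous map. -/
def SingularH1.map {X X' : Type u} [TopologicalSpace X] [TopologicalSpace X'] (f : C(X, X')) :
    SingularH1 X →ₗ[ℤ] SingularH1 X' :=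
  (((AlgebraicTopology.singularHomologyFunctor (ModuleCat.{u} ℤ) 1).obj
    (ModuleCat.of ℤ (ULift.{u} ℤ))).map (TopCat.ofHom f)).hom

/-- The homomorphism `H₁(S¹; ℤ) → H₁(X; ℤ)` induced by a closed curve in `X`
(with the circle lifted to the universe of `X`). -/
def curveH1 {X : Type u} [TopologicalSpace X] (γ : C(Circle, X)) :
    SingularH1 (ULift.{u} Circle) →ₗ[ℤ] SingularH1 X :=
  SingularH1.map (γ.comp ⟨ULift.down, continuous_uliftDown⟩)

/-- A smooth surface is orientable if it is covered by smooth charts whose transition maps have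
everywhere positive Jacobian determinant. -/
def IsOrientableSurface (S : Type u) [TopologicalSpace S]
    [ChartedSpace (EuclideanSpace ℝ (Fin 2)) S] : Prop :=
  ∃ A : Set (OpenPartialHomeomorph S (EuclideanSpace ℝ (Fin 2))),
    A ⊆ IsManifold.maximalAtlas (𝓡 2) ∞ S ∧
    (∀ x : S, ∃ φ ∈ A, x ∈ φ.source) ∧
    ∀ φ ∈ A, ∀ ψ ∈ A, ∀ p ∈ (φ.symm.trans ψ).source,
      0 < (fderiv ℝ (φ.symm.trans ψ) p).det

/-- `S` is a closed (compact, connected, without boundary), orientable smooth surface of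
genus `g`, the genus being half the rank of `H₁(S; ℤ)`. -/
structure IsClosedOrientableSurface (g : ℕ) (S : Type u) [TopologicalSpace S]
    [ChartedSpace (EuclideanSpace ℝ (Fin 2)) S] : Prop where
  t2 : T2Space S
  compact : CompactSpace S
  connected : ConnectedSpace S
  smooth : IsManifold (𝓡 2) ∞ S
  orientable : IsOrientableSurface S
  genus : Nonempty (SingularH1 S ≃ₗ[ℤ] (Fin (2 * g) → ℤ))

/-- `γ` is a `g`-tuple of pairwise disjoint smooth simple closed curves on `S` whose classes in
`H₁(S; ℤ)` are linearly independent. -/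
structure IsAttachingSystem {g : ℕ} {S : Type u} [TopologicalSpace S]
    [ChartedSpace (EuclideanSpace ℝ (Fin 2)) S] (γ : Fin g → C(Circle, S)) : Prop where
  embedding : ∀ i, Manifold.IsSmoothEmbedding (𝓡 1) (𝓡 2) ∞ (γ i)
  disjoint : Pairwise fun i j => Disjoint (Set.range (γ i)) (Set.range (γ j))
  /-- As `H₁(S¹; ℤ)` is infinite cyclic and the generator of the `i`-th copy is sent to the class
  of `γ i`, this is linear independence of the classes of the `γ i`. -/
  linearIndependent : ∀ z : Fin g → SingularH1 (ULift.{u} Circle),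
    ∑ i, curveH1 (γ i) (z i) = 0 → z = 0

/-- Two smooth closed curves on a surface are transverse if at every common point their tangent
lines span the tangent plane. (The tangent space of `S` at a point is the model plane, through
the preferred chart at that point, so the two tangent lines lie in one plane.) -/
def TransverseCurves {S : Type u} [TopologicalSpace S]
    [ChartedSpace (EuclideanSpace ℝ (Fin 2)) S] (γ δ : C(Circle, S)) : Prop :=
  ∀ s t : Circle, γ s = δ t →
    LinearMap.range (mfderiv (𝓡 1) (𝓡 2) γ s :
        EuclideanSpace ℝ (Fin 1) →L[ℝ] EuclideanSpace ℝ (Fin 2)).toLinearMap ⊔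
      LinearMap.range (mfderiv (𝓡 1) (𝓡 2) δ t :
        EuclideanSpace ℝ (Fin 1) →L[ℝ] EuclideanSpace ℝ (Fin 2)).toLinearMap = ⊤

/-- A Heegaard diagram `(S, α, β)` of genus `g`. -/
structure HeegaardDiagram (g : ℕ) (S : Type u) [TopologicalSpace S]
    [ChartedSpace (EuclideanSpace ℝ (Fin 2)) S] where
  surface : IsClosedOrientableSurface g S
  α : Fin g → C(Circle, S)
  β : Fin g → C(Circle, S)
  isAttachingSystem_α : IsAttachingSystem α
  isAttachingSystem_β : IsAttachingSystem β
  transverse : ∀ i j, TransverseCurves (α i) (β j)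

/-- The closed 3-ball. -/
abbrev Ball3 : Type := Metric.closedBall (0 : EuclideanSpace ℝ (Fin 3)) 1

/-- The standard 3-dimensional handle `D² × [-1, 1]`. As a 1-handle it is attached along the two
discs `D² × {±1}` and has belt circle `∂D² × {0}`; read upside down, as a 2-handle, it is attached
along the annulus `∂D² × [-1, 1]` and has attaching circle `∂D² × {0}`. -/
abbrev Handle3 : Type := Metric.closedBall (0 : ℂ) 1 × Set.Icc (-1 : ℝ) 1

/-- The point `(z, 0)` of the circle `∂D² × {0}` of the standard handle. -/
def Handle3.belt (z : Circle) : Handle3 :=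
  (⟨(z : ℂ), by simp [Circle.norm_coe]⟩, ⟨0, by simp⟩)

/-- The subset `U` of `Y` is a handlebody with boundary the embedded surface `e : S → Y`, and the
curves `γ i` on `S` bound the cores `D² × {0}` of its handles: `U` is a 3-ball with `g` disjoint
1-handles attached to its boundary sphere, the belt circles of which are the curves `e ∘ γ i`. -/
def IsHandlebodyWithBeltCircles {g : ℕ} {S Y : Type u} [TopologicalSpace S] [TopologicalSpace Y]
    (e : S → Y) (γ : Fin g → C(Circle, S)) (U : Set Y) : Prop :=
  ∃ (b : Ball3 → Y) (h : Fin g → Handle3 → Y),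
    Topology.IsEmbedding b ∧ (∀ i, Topology.IsEmbedding (h i)) ∧
    -- `U` is the union of the ball and the handles
    U = Set.range b ∪ ⋃ i, Set.range (h i) ∧
    -- the handles are pairwise disjoint
    (Pairwise fun i j => Disjoint (Set.range (h i)) (Set.range (h j))) ∧
    -- each handle meets the ball exactly in its two end discs ...
    (∀ i, Set.range (h i) ∩ Set.range b = h i '' {p | |(p.2 : ℝ)| = 1}) ∧
    -- ... which lie in the boundary sphere of the ball
    (∀ i, h i '' {p | |(p.2 : ℝ)| = 1} ⊆ b '' {x | ‖(x : EuclideanSpace ℝ (Fin 3))‖ = 1}) ∧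
    -- the surface is the boundary: the sphere without the open end discs, and the side annuli
    Set.range e =
      (b '' {x | ‖(x : EuclideanSpace ℝ (Fin 3))‖ = 1} \
          ⋃ i, h i '' {p | ‖(p.1 : ℂ)‖ < 1 ∧ |(p.2 : ℝ)| = 1}) ∪
        ⋃ i, h i '' {p | ‖(p.1 : ℂ)‖ = 1} ∧
    -- the belt circle of the `i`-th handle is `γ i`
    ∀ i z, h i (Handle3.belt z) = e (γ i z)

namespace HeegaardDiagram

variable {g : ℕ} {S : Type u} [TopologicalSpace S] [ChartedSpace (EuclideanSpace ℝ (Fin 2)) S]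

/-- `Y` is the closed 3-manifold determined by the Heegaard diagram: `S` embeds in `Y` as a surface
separating it into two handlebodies, the `α` curves being the belt circles of the 1-handles of `Y`
(those of the first handlebody, its ball being the 0-handle) and the `β` curves the attaching
circles of the 2-handles of `Y` (those of the second handlebody read upside down, its ball being
the 3-handle). -/
def IsDiagramOf (H : HeegaardDiagram g S) (Y : Type u) [TopologicalSpace Y] : Prop :=
  ∃ (e : S → Y) (U V : Set Y), Topology.IsEmbedding e ∧
    U ∪ V = Set.univ ∧ U ∩ V = Set.range e ∧
    IsHandlebodyWithBeltCircles e H.α U ∧ IsHandlebodyWithBeltCircles e H.β V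

/-- The points of `𝕋_α ∩ 𝕋_β` in the `g`-fold symmetric product: tuples `(x₁, …, x_g)` with
`x_i ∈ α_i ∩ β_{σ(i)}` for some permutation `σ`. (As the `α` curves are disjoint, ordering an
unordered point by the `α` curves loses nothing.) -/
def generators (H : HeegaardDiagram g S) : Set (Fin g → S) :=
  {x | ∃ σ : Equiv.Perm (Fin g),
    ∀ i, x i ∈ Set.range (H.α i) ∩ Set.range (H.β (σ i))}

/-- The Heegaard Floer chain group: the free abelian group on `𝕋_α ∩ 𝕋_β`. -/
abbrev CFHat (H : HeegaardDiagram g S) : Type u := H.generators →₀ ℤ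

end HeegaardDiagram

/-- `Y` is a strong L-space: `H₁(Y; ℤ)` is finite and `Y` has a Heegaard diagram whose chain group
is isomorphic to `ℤ ^ |H₁(Y; ℤ)|`. -/
def IsStrongLSpace (Y : Type u) [TopologicalSpace Y] : Prop :=
  Finite (SingularH1 Y) ∧
  ∃ (g : ℕ) (S : Type u) (_ : TopologicalSpace S) (_ : ChartedSpace (EuclideanSpace ℝ (Fin 2)) S)
    (H : HeegaardDiagram g S),
    H.IsDiagramOf Y ∧ Nonempty (H.CFHat ≃+ (Fin (Nat.card (SingularH1 Y)) → ℤ))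

end

/-! ### Parallel transport and locally flat sections. -/

noncomputable section

open Topology unitInterval Set

/-! A Heegaard diagram gives generators of π₁(Y), one for each handle of the α-handlebody, and
relators, one for each β curve, spelled by crossings of the curve with the core discs. Let M be the
square matrix of exponent sums of the relators. The group H₁ is a quotient of the cokernel of M, and
M is nonsingular when H₁ is finite, so |H₁| ≤ |det M|. Expand det M letter by letter: the nonzero
terms are the choices of one letter from each relator such that the generators chosen are distinct.
Each term is ±1, and distinct terms give distinct points of 𝕋_α ∩ 𝕋_β. A strong L-space has exactly
|H₁| such points, so the number of terms is at most |det M|. Hence nothing cancels and all terms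
have the same sign.

Now let π₁(Y) be left-ordered and let s be the vector of signs (-1, 0 or 1) of the generators. A
product of elements ≥ 1 equals 1 only if every factor is 1, and likewise for ≤. So in each relator
either all letters are trivial or both signs occur, and positive weights on its letters make the
weighted sum of signs vanish. The weighted matrix therefore kills s. Its determinant is a sum of
positive multiples of terms of one sign, so it is nonzero. Thus s = 0, all generators are trivial,
and the group is trivial. This is `not_leftOrderable_of_words`, resting on
`LetterMatrix.det_mat_ne_zero`.

The topological input uses parallel transport instead of van Kampen's theorem, and comes down to
three facts. The transport along a curve in a handlebody is conjugate to the value of a word whose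
letters are distinct crossings with the cores; the word does not depend on the structure group
(`Handlebody.exists_word_curve`). The handle loops generate the holonomy group, since a subgroup
containing them yields a global parallel section of its coset bundle
(`HeegaardSplitting.closure_gen_eq_top`). Finally, an integral kernel vector of M extends to a map
from Y to the circle, whose periods define a homomorphism from H₁ to ℝ; this must vanish when H₁ is
finite (`Spells.det_ne_zero`). The Hurewicz map links transports with singular homology. -/

/-- A locally trivial, homotopy invariant and multiplicative assignment of group elements to the
paths of a space: the parallel transport of a principal bundle with discrete structure group in a
(discontinuous) trivialization. The order of the factors is that of composition of transports. -/
structure Holonomy (X : Type*) [TopologicalSpace X] (Γ : Type*) [Group Γ] where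
  hol : ∀ {p q : X}, Path p q → Γ
  hol_trans : ∀ {p q r : X} (γ : Path p q) (δ : Path q r), hol (γ.trans δ) = hol δ * hol γ
  hol_homotopic : ∀ {p q : X} {γ δ : Path p q}, γ.Homotopic δ → hol γ = hol δ
  exists_trivial_nhds : ∀ p : X, ∃ W ∈ 𝓝 p, ∀ {q r : X} (γ δ : Path q r),
    range γ ⊆ W → range δ ⊆ W → hol γ = hol δ

namespace Holonomy

variable {X : Type*} [TopologicalSpace X] {Γ : Type*} [Group Γ] (H : Holonomy X Γ)

theorem hol_congr {p q p' q' : X} {γ : Path p q} {δ : Path p' q'} (h : ∀ t, γ t = δ t) :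
    H.hol γ = H.hol δ := by
  obtain rfl : p = p' := by simpa using h 0
  obtain rfl : q = q' := by simpa using h 1
  rw [Path.ext (funext h)]

@[simp] theorem hol_refl (p : X) : H.hol (Path.refl p) = 1 := by
  have h := H.hol_trans (Path.refl p) (Path.refl p)
  rw [Path.refl_trans_refl] at h
  simpa using h

theorem hol_subpath_trans {p q : X} (γ : Path p q) (a b c : I) :
    H.hol (γ.subpath a c) = H.hol (γ.subpath b c) * H.hol (γ.subpath a b) := by
  rw [← H.hol_trans]
  exact (H.hol_homotopic ⟨Path.Homotopy.subpathTransSubpath γ a b c⟩).symm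

theorem hol_subpath_zero_one {p q : X} (γ : Path p q) : H.hol (γ.subpath 0 1) = H.hol γ :=
  H.hol_congr fun t => by simp

/-- The holonomy of the images of paths under a continuous map. -/
def pullback {Z : Type*} [TopologicalSpace Z] {f : Z → X} (hf : Continuous f) :
    Holonomy Z Γ where
  hol γ := H.hol (γ.map hf)
  hol_trans γ δ := by rw [Path.map_trans, H.hol_trans]
  hol_homotopic h := H.hol_homotopic (h.map ⟨f, hf⟩)
  exists_trivial_nhds p := by
    obtain ⟨W, hW, h⟩ := H.exists_trivial_nhds (f p)
    refine ⟨f ⁻¹' W, hf.continuousAt.preimage_mem_nhds hW, fun γ δ hγ hδ => h _ _ ?_ ?_⟩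
    · rintro _ ⟨t, rfl⟩; exact hγ ⟨t, rfl⟩
    · rintro _ ⟨t, rfl⟩; exact hδ ⟨t, rfl⟩

theorem pullback_hol {Z : Type*} [TopologicalSpace Z] {f : Z → X} (hf : Continuous f) {p q : Z}
    (γ : Path p q) : (H.pullback hf).hol γ = H.hol (γ.map hf) := rfl

/-- The common transport along all paths between two points of a simply connected space. -/
def tr [PathConnectedSpace X] (p q : X) : Γ := H.hol (PathConnectedSpace.somePath p q)

theorem hol_eq_tr [SimplyConnectedSpace X] {p q : X} (γ : Path p q) : H.hol γ = H.tr p q :=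
  H.hol_homotopic (SimplyConnectedSpace.paths_homotopic _ _)

@[simp] theorem tr_self [SimplyConnectedSpace X] (p : X) : H.tr p p = 1 := by
  rw [← H.hol_eq_tr (Path.refl p), hol_refl]

theorem tr_mul_tr [SimplyConnectedSpace X] (p q r : X) : H.tr q r * H.tr p q = H.tr p r := by
  rw [tr, tr, ← H.hol_trans, hol_eq_tr]

end Holonomy

/-- A path in the image of an embedding comes from a path in the source. -/
theorem Topology.IsEmbedding.exists_path_map_eq {C X : Type*} [TopologicalSpace C]
    [TopologicalSpace X] {j : C → X} (hj : IsEmbedding j) {c d : C} (γ : Path (j c) (j d))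
    (hγ : range γ ⊆ range j) : ∃ δ : Path c d, δ.map hj.continuous = γ := by
  choose f hf using fun t => hγ ⟨t, rfl⟩
  refine ⟨⟨⟨f, ?_⟩, ?_, ?_⟩, ?_⟩
  · rw [hj.continuous_iff]
    exact γ.continuous.congr fun t => (hf t).symm
  · exact hj.injective (by simp [hf])
  · exact hj.injective (by simp [hf])
  · ext t; exact hf t

namespace Holonomy

variable {X : Type*} [TopologicalSpace X] {Γ : Type*} [Group Γ] (H : Holonomy X Γ)

theorem hol_eq_tr_of_range_subset {C : Type*} [TopologicalSpace C] [SimplyConnectedSpace C]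
    {j : C → X} (hj : IsEmbedding j) {c d : C} {p q : X} (γ : Path p q) (hp : p = j c)
    (hq : q = j d) (hγ : range γ ⊆ range j) :
    H.hol γ = (H.pullback hj.continuous).tr c d := by
  subst hp hq
  obtain ⟨δ, rfl⟩ := hj.exists_path_map_eq γ hγ
  exact (H.pullback hj.continuous).hol_eq_tr δ

variable {M : Type*} [MulAction Γ M]

/-- A section of the associated bundle with discrete fibre `M` is locally flat on `F` if it is
parallel along short paths between points of `F`. -/
def LocFlat (s : X → M) (F : Set X) : Prop :=
  ∀ p ∈ F, ∃ N ∈ 𝓝 p, ∀ q ∈ N ∩ F, ∀ γ : Path p q, range γ ⊆ N → s q = H.hol γ • s p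

variable {H}

theorem LocFlat.congr {s s' : X → M} {F : Set X} (h : H.LocFlat s F) (hs : EqOn s s' F) :
    H.LocFlat s' F := by
  intro p hp
  obtain ⟨N, hN, h⟩ := h p hp
  exact ⟨N, hN, fun q hq γ hγ => by rw [← hs hq.2, ← hs hp, h q hq γ hγ]⟩

/-- Nearby points of the image are joined by a short path inside the image, and local triviality of
the holonomy allows any short ambient path to be replaced by that one. -/
theorem LocFlat.of_range {C : Type*} [TopologicalSpace C] [LocallyPathConnectedSpace C]
    {j : C → X} (hj : IsEmbedding j) {s : X → M}
    (h : ∀ (c d : C) (δ : Path c d), s (j d) = H.hol (δ.map hj.continuous) • s (j c)) :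
    H.LocFlat s (range j) := by
  rintro _ ⟨c, rfl⟩
  obtain ⟨W, hW, hWt⟩ := H.exists_trivial_nhds (j c)
  obtain ⟨V, ⟨hV, hVc⟩, hVW⟩ :=
    (path_connected_basis c).mem_iff.1 (hj.continuous.continuousAt.preimage_mem_nhds hW)
  rw [hj.nhds_eq_comap] at hV
  obtain ⟨N, hN, hNV⟩ := hV
  refine ⟨N ∩ W, Filter.inter_mem hN hW, ?_⟩
  rintro _ ⟨hqN, d, rfl⟩ γ hγ
  obtain ⟨δ, hδ⟩ := hVc.joinedIn c (hNV (mem_of_mem_nhds hN : j c ∈ N)) d (hNV hqN.1)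
  rw [h c d δ, hWt γ (δ.map hj.continuous) (hγ.trans inter_subset_right)]
  rintro _ ⟨t, rfl⟩
  exact hVW (hδ t)

/-- The closure condition makes each piece relatively closed in the union, so a point outside a
piece has a neighbourhood that misses it. Only pieces through the point impose a condition. -/
theorem LocFlat.iUnion {ι : Type*} [Finite ι] {F : ι → Set X} {s : X → M}
    (h : ∀ i, H.LocFlat s (F i)) (hc : ∀ i j, closure (F i) ∩ F j ⊆ F i) :
    H.LocFlat s (⋃ i, F i) := by
  intro p hp
  obtain ⟨i₀, hi₀⟩ := mem_iUnion.1 hp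
  have : ∀ i, ∃ N ∈ 𝓝 p, ∀ q ∈ N ∩ F i, ∀ γ : Path p q, range γ ⊆ N → s q = H.hol γ • s p := by
    intro i
    by_cases hpi : p ∈ F i
    · exact h i p hpi
    · refine ⟨(closure (F i))ᶜ, isClosed_closure.isOpen_compl.mem_nhds
        fun hp' => hpi (hc i i₀ ⟨hp', hi₀⟩), fun q hq => (hq.1 (subset_closure hq.2)).elim⟩
  choose N hN hs using this
  refine ⟨⋂ i, N i, Filter.iInter_mem.2 hN, ?_⟩
  rintro q ⟨hqN, hqF⟩ γ hγ
  obtain ⟨i, hi⟩ := mem_iUnion.1 hqF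
  exact hs i q ⟨mem_iInter.1 hqN i, hi⟩ γ (hγ.trans (iInter_subset _ i))

theorem LocFlat.union {F G : Set X} {s : X → M} (hF : H.LocFlat s F) (hG : H.LocFlat s G)
    (hFc : closure F ∩ G ⊆ F) (hGc : closure G ∩ F ⊆ G) : H.LocFlat s (F ∪ G) := by
  rw [union_eq_iUnion]
  refine LocFlat.iUnion (fun b => by cases b <;> assumption) fun a b => ?_
  cases a <;> cases b <;> first | assumption | exact inter_subset_right

/-- Transporting the section back to the start of the path gives a locally constant function on the
connected unit interval. -/
theorem LocFlat.smul_eq {F : Set X} {s : X → M} (h : H.LocFlat s F) {p q : X} (γ : Path p q)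
    (hγ : range γ ⊆ F) : s q = H.hol γ • s p := by
  have hF : ∀ t, γ t ∈ F := fun t => hγ ⟨t, rfl⟩
  have key : IsLocallyConstant fun t : I => (H.hol (γ.subpath 0 t))⁻¹ • s (γ t) := by
    rw [IsLocallyConstant.iff_eventually_eq]
    intro x
    obtain ⟨N, hN, hs⟩ := h (γ x) (hF x)
    obtain ⟨V, hV, hVN⟩ : ∃ V ∈ 𝓝 x, ∀ y ∈ V, uIcc x y ⊆ γ ⁻¹' N := by
      obtain ⟨ε, hε, hb⟩ := Metric.mem_nhds_iff.1 (γ.continuous.continuousAt.preimage_mem_nhds hN)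
      refine ⟨_, Metric.ball_mem_nhds x hε, fun y hy z hz => hb ?_⟩
      refine lt_of_le_of_lt ?_ (Metric.mem_ball.1 hy)
      rw [dist_comm z, dist_comm y]
      have hz' : (z : ℝ) ∈ uIcc (x : ℝ) y := by
        rcases le_total x y with hxy | hxy
        · rw [uIcc_of_le hxy] at hz; exact Icc_subset_uIcc hz
        · rw [uIcc_of_ge hxy] at hz; exact Icc_subset_uIcc' hz
      exact Real.dist_left_le_of_mem_uIcc hz'
    filter_upwards [hV] with y hy
    have hr : range (γ.subpath x y) ⊆ N := by
      rw [Path.range_subpath]; exact image_subset_iff.2 (hVN y hy)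
    rw [hs (γ y) ⟨hr ⟨1, Path.target _⟩, hF y⟩ (γ.subpath x y) hr, H.hol_subpath_trans γ 0 x y]
    simp [mul_smul]
  have h01 := key.apply_eq_of_preconnectedSpace 0 1
  simp only [Path.subpath_self, hol_refl, inv_one, one_smul, hol_subpath_zero_one, Path.source,
    Path.target] at h01
  rw [h01, smul_inv_smul]

/-- Attachment of disjoint simply connected cells: transport from one attached point defines the
section on a cell, and `hjF` says that it agrees with the given one at all other attached points. -/
theorem LocFlat.exists_extend {ι C : Type*} [Finite ι] [TopologicalSpace C] [CompactSpace C]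
    [T2Space X] [SimplyConnectedSpace C] [LocallyPathConnectedSpace C] {j : ι → C → X}
    (hj : ∀ i, IsEmbedding (j i)) (hd : Pairwise fun i k => Disjoint (range (j i)) (range (j k)))
    {F : Set X} (hFc : IsClosed F) {s : X → M} (hs : H.LocFlat s F)
    (hne : ∀ i, ∃ c, j i c ∈ F)
    (hjF : ∀ i c d, j i c ∈ F → j i d ∈ F →
      s (j i d) = (H.pullback (hj i).continuous).tr c d • s (j i c)) :
    ∃ s' : X → M, EqOn s s' F ∧ H.LocFlat s' (F ∪ ⋃ i, range (j i)) := by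
  classical
  choose c₀ hc₀ using hne
  let J : ι × C → X := fun a => j a.1 a.2
  let φ : ι × C → M := fun a => (H.pullback (hj a.1).continuous).tr (c₀ a.1) a.2 • s (j a.1 (c₀ a.1))
  have hJ : Function.Injective J := by
    rintro ⟨i, c⟩ ⟨k, d⟩ h
    obtain rfl : i = k := by
      by_contra hik
      exact disjoint_left.1 (hd hik) ⟨c, rfl⟩ ⟨d, h.symm⟩
    obtain rfl : c = d := (hj i).injective h
    rfl
  let s' : X → M := F.piecewise s (Function.extend J φ s)
  have hF : EqOn s s' F := fun p hp => (piecewise_eq_of_mem F _ _ hp).symm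
  have hs'j : ∀ i c, s' (j i c) = φ (i, c) := by
    intro i c
    by_cases h : j i c ∈ F
    · rw [← hF h, hjF i (c₀ i) c (hc₀ i) h]
    · exact (piecewise_eq_of_notMem F _ _ h).trans (hJ.extend_apply φ s (i, c))
  have hcl : ∀ i, IsClosed (range (j i)) := fun i =>
    (isCompact_range (hj i).continuous).isClosed
  refine ⟨s', hF, (hs.congr hF).union (LocFlat.iUnion (fun i => LocFlat.of_range (hj i) ?_) ?_)
    ?_ ?_⟩
  · intro c d δ
    rw [hs'j, hs'j, smul_smul, ← H.pullback_hol, hol_eq_tr, tr_mul_tr]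
  · intro i k
    rw [(hcl i).closure_eq]; exact inter_subset_left
  · rw [hFc.closure_eq]; exact inter_subset_left
  · rw [(isClosed_iUnion_of_finite hcl).closure_eq]; exact inter_subset_left

end Holonomy

end

/-! ### The holonomies of the universal cover and of a circle-valued map. -/

noncomputable section

open Topology unitInterval Set

/-- Every point has a neighbourhood in which paths with the same end points are homotopic in the
ambient space. -/
def SemilocallySimplyConnected (X : Type*) [TopologicalSpace X] : Prop :=
  ∀ p : X, ∃ W ∈ 𝓝 p, ∀ {q r : X} (γ δ : Path q r), range γ ⊆ W → range δ ⊆ W → γ.Homotopic δ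

theorem Topology.IsEmbedding.homotopic_of_range_subset {C X : Type*} [TopologicalSpace C]
    [SimplyConnectedSpace C] [TopologicalSpace X] {j : C → X} (hj : IsEmbedding j) {q r : X}
    (γ δ : Path q r) (hγ : range γ ⊆ range j) (hδ : range δ ⊆ range j) : γ.Homotopic δ := by
  obtain ⟨c, rfl⟩ : q ∈ range j := hγ ⟨0, γ.source⟩
  obtain ⟨d, rfl⟩ : r ∈ range j := hγ ⟨1, γ.target⟩
  obtain ⟨γ', rfl⟩ := hj.exists_path_map_eq γ hγ
  obtain ⟨δ', rfl⟩ := hj.exists_path_map_eq δ hδ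
  exact (SimplyConnectedSpace.paths_homotopic γ' δ').map ⟨j, hj.continuous⟩

theorem ChartedSpace.semilocallySimplyConnected (E X : Type*) [NormedAddCommGroup E]
    [NormedSpace ℝ E] [TopologicalSpace X] [ChartedSpace E X] : SemilocallySimplyConnected X := by
  intro p
  let φ := chartAt E p
  have hp : p ∈ φ.source := mem_chart_source E p
  obtain ⟨ε, hε, hb⟩ := Metric.mem_nhds_iff.1 (φ.open_target.mem_nhds (φ.map_source hp))
  let j : Metric.ball (φ p) ε → X := fun z => φ.symm z
  have hj : IsEmbedding j := by
    have h1 : IsEmbedding (φ.target.domRestrict φ.symm) := by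
      have := φ.symm.isOpenEmbedding_restrict
      exact this.isEmbedding
    exact h1.comp (IsEmbedding.inclusion hb)
  have : ContractibleSpace (Metric.ball (φ p) ε) :=
    (convex_ball _ _).contractibleSpace ⟨_, Metric.mem_ball_self hε⟩
  refine ⟨range j, ?_, fun γ δ hγ hδ => hj.homotopic_of_range_subset γ δ hγ hδ⟩
  have : range j = φ.symm '' Metric.ball (φ p) ε := by
    ext z; simp [j]
  rw [this]
  exact (φ.symm.isOpen_image_of_subset_source Metric.isOpen_ball hb).mem_nhds
    ⟨φ p, Metric.mem_ball_self hε, φ.left_inv hp⟩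

open Path in
/-- The holonomy of the universal cover. -/
def fundamentalHolonomy {Y : Type*} [TopologicalSpace Y] [PathConnectedSpace Y]
    (hY : SemilocallySimplyConnected Y) (y : Y) : Holonomy Y (FundamentalGroup Y y) where
  hol {p q} γ := FundamentalGroup.fromPath (Homotopic.Quotient.trans (Homotopic.Quotient.trans
    (Homotopic.Quotient.mk (PathConnectedSpace.somePath y p)) (Homotopic.Quotient.mk γ))
    (Homotopic.Quotient.symm (Homotopic.Quotient.mk (PathConnectedSpace.somePath y q))))
  hol_trans γ δ := by
    rw [FundamentalGroup.mul_def, Homotopic.Quotient.mk_trans]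
    simp only [Homotopic.Quotient.trans_assoc]
    congr 2
    rw [← Homotopic.Quotient.trans_assoc (Homotopic.Quotient.symm _), Homotopic.Quotient.symm_trans, Homotopic.Quotient.refl_trans]
  hol_homotopic h := by rw [Homotopic.Quotient.eq.2 h]
  exists_trivial_nhds p := by
    obtain ⟨W, hW, h⟩ := hY p
    exact ⟨W, hW, fun γ δ hγ hδ => by rw [Homotopic.Quotient.eq.2 (h γ δ hγ hδ)]⟩

open Path in
theorem fundamentalHolonomy_surjective {Y : Type*} [TopologicalSpace Y] [PathConnectedSpace Y]
    (hY : SemilocallySimplyConnected Y) (y : Y) (g : FundamentalGroup Y y) :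
    ∃ γ : Path y y, (fundamentalHolonomy hY y).hol γ = g := by
  obtain ⟨δ, hδ⟩ := Homotopic.Quotient.mk_surjective g.toPath
  let c := PathConnectedSpace.somePath y y
  -- The chosen path from the base point to itself need not be constant, so it is cancelled by
  -- conjugation.
  refine ⟨(c.symm.trans δ).trans c, ?_⟩
  change Homotopic.Quotient.trans (Homotopic.Quotient.trans (Homotopic.Quotient.mk c) (Homotopic.Quotient.mk ((c.symm.trans δ).trans c)))
    (Homotopic.Quotient.symm (Homotopic.Quotient.mk c)) = g.toPath
  rw [← hδ]
  simp only [Homotopic.Quotient.mk_trans, Homotopic.Quotient.mk_symm, Homotopic.Quotient.trans_assoc, Homotopic.Quotient.trans_symm,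
    Homotopic.Quotient.trans_refl]
  rw [← Homotopic.Quotient.trans_assoc, Homotopic.Quotient.trans_symm, Homotopic.Quotient.refl_trans]

/-- Push a holonomy forward along a group homomorphism. -/
def Holonomy.mapGroup {X Γ Γ' : Type*} [TopologicalSpace X] [Group Γ] [Group Γ']
    (H : Holonomy X Γ) (φ : Γ →* Γ') : Holonomy X Γ' where
  hol γ := φ (H.hol γ)
  hol_trans γ δ := by rw [H.hol_trans, map_mul]
  hol_homotopic h := by rw [H.hol_homotopic h]
  exists_trivial_nhds p := by
    obtain ⟨W, hW, h⟩ := H.exists_trivial_nhds p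
    exact ⟨W, hW, fun γ δ hγ hδ => by rw [h γ δ hγ hδ]⟩

namespace AddCircle

theorem exists_path_lift (f : C(I, AddCircle (1 : ℝ))) (e : ℝ) (he : (e : AddCircle (1 : ℝ)) = f 0) :
    ∃ L : C(I, ℝ), (∀ t, (L t : AddCircle (1 : ℝ)) = f t) ∧ L 0 = e := by
  obtain ⟨L, hL, h0⟩ := (AddCircle.isCoveringMap_coe (1 : ℝ)).exists_path_lifts f e he.symm
  exact ⟨L, fun t => congrFun hL t, h0⟩

theorem lift_sub_eq {Z : Type*} [TopologicalSpace Z] [PreconnectedSpace Z] {L L' : Z → ℝ}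
    (hL : Continuous L) (hL' : Continuous L')
    (h : ∀ t, (L t : AddCircle (1 : ℝ)) = L' t) (a b : Z) : L b - L a = L' b - L' a := by
  have := (AddCircle.isCoveringMap_coe (1 : ℝ)).const_of_comp (hL.sub hL')
    (fun a a' => by simp [h]) a b
  simp only [Pi.sub_apply] at this
  linarith

/-- The increment of a real-valued lift of a path in the circle `ℝ / ℤ`. -/
def liftDiff (f : C(I, AddCircle (1 : ℝ))) : ℝ :=
  (exists_path_lift f _ (Quotient.out_eq' (f 0))).choose 1 -
    (exists_path_lift f _ (Quotient.out_eq' (f 0))).choose 0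

theorem liftDiff_eq {f : C(I, AddCircle (1 : ℝ))} {L : I → ℝ} (hL : Continuous L)
    (h : ∀ t, (L t : AddCircle (1 : ℝ)) = f t) : liftDiff f = L 1 - L 0 := by
  have := (exists_path_lift f _ (Quotient.out_eq' (f 0))).choose_spec.1
  exact lift_sub_eq (ContinuousMap.continuous _) hL (fun t => by rw [this, h]) 0 1

end AddCircle

open AddCircle in
/-- The holonomy of the covering of `X` pulled back from `ℝ → ℝ / ℤ`. -/
def liftHolonomy {X : Type*} [TopologicalSpace X] (f : C(X, AddCircle (1 : ℝ))) :
    Holonomy X (Multiplicative ℝ) where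
  hol γ := Multiplicative.ofAdd (liftDiff (f.comp γ.toContinuousMap))
  hol_trans {p q r} γ δ := by
    obtain ⟨L, hL, -⟩ := exists_path_lift (f.comp γ.toContinuousMap) _
      (Quotient.out_eq' _)
    obtain ⟨L', hL', h0⟩ := exists_path_lift (f.comp δ.toContinuousMap) (L 1) (by simp [hL])
    let P : Path (L 0) (L 1) := ⟨L, rfl, rfl⟩
    let P' : Path (L 1) (L' 1) := ⟨L', h0, rfl⟩
    rw [liftDiff_eq L.continuous hL, liftDiff_eq L'.continuous hL',
      liftDiff_eq (L := P.trans P') (P.trans P').continuous, ← ofAdd_add]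
    · congr 1
      simp only [Path.target, Path.source, h0]
      ring
    · intro t
      simp only [Path.trans_apply, ContinuousMap.comp_apply, Path.coe_toContinuousMap]
      split_ifs
      · exact hL _
      · exact hL' _
  hol_homotopic {p q γ δ} h := by
    congr 1
    obtain ⟨L, hL, h0⟩ := exists_path_lift (f.comp γ.toContinuousMap) _
      (Quotient.out_eq' _)
    obtain ⟨L', hL', h0'⟩ := exists_path_lift (f.comp δ.toContinuousMap) (L 0) (by simp [hL])
    have cov := AddCircle.isCoveringMap_coe (1 : ℝ)
    have h1 : ((f.comp γ.toContinuousMap) 0 : AddCircle (1 : ℝ)) = (L 0 : ℝ) := (hL 0).symm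
    have h2 : ((f.comp δ.toContinuousMap) 0 : AddCircle (1 : ℝ)) = (L 0 : ℝ) := by simp [hL]
    have key := cov.liftPath_apply_one_eq_of_homotopicRel
      (ContinuousMap.HomotopicRel.comp_continuousMap h f) (L 0) h1 h2
    rw [← (cov.eq_liftPath_iff' h1).2 ⟨funext hL, rfl⟩,
      ← (cov.eq_liftPath_iff' h2).2 ⟨funext hL', h0'⟩] at key
    rw [liftDiff_eq L.continuous hL, liftDiff_eq L'.continuous hL', key, h0']
  exists_trivial_nhds p := by
    obtain ⟨e, he⟩ := QuotientAddGroup.mk_surjective (f p)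
    obtain ⟨φ, heφ, hφ⟩ := (AddCircle.isLocalHomeomorph_coe (1 : ℝ)) e
    have hφ' : ∀ z ∈ φ.target, ((φ.symm z : ℝ) : AddCircle (1 : ℝ)) = z := fun z hz => by
      rw [hφ]; exact φ.right_inv hz
    refine ⟨f ⁻¹' φ.target, f.continuous.continuousAt.preimage_mem_nhds
      (φ.open_target.mem_nhds ?_), ?_⟩
    · rw [← he]; rw [hφ]; exact φ.map_source heφ
    -- Over the target of a local inverse of the covering, that inverse supplies the lift, so the
    -- increment depends on the end points only.
    · have : ∀ {q r : X} (γ : Path q r), range γ ⊆ f ⁻¹' φ.target →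
          liftDiff (f.comp γ.toContinuousMap) = φ.symm (f r) - φ.symm (f q) := by
        intro q r γ hγ
        have hγ' : ∀ t, f (γ t) ∈ φ.target := fun t => hγ ⟨t, rfl⟩
        rw [liftDiff_eq (L := fun t => φ.symm (f (γ t)))]
        · simp
        · exact φ.continuousOn_symm.comp_continuous (by fun_prop) hγ'
        · exact fun t => hφ' _ (hγ' t)
      intro q r γ δ hγ hδ
      rw [this γ hγ, this δ hδ]

theorem liftHolonomy_hol {X : Type*} [TopologicalSpace X] (f : C(X, AddCircle (1 : ℝ))) {p q : X}
    (γ : Path p q) {L : I → ℝ} (hL : Continuous L)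
    (h : ∀ t, (L t : AddCircle (1 : ℝ)) = f (γ t)) :
    (liftHolonomy f).hol γ = Multiplicative.ofAdd (L 1 - L 0) :=
  congrArg Multiplicative.ofAdd
    (AddCircle.liftDiff_eq (f := f.comp γ.toContinuousMap) hL h)

end

/-! ### Singular chains on simplices, and classes of paths modulo boundaries. -/

noncomputable section

open Topology unitInterval Set CategoryTheory Simplicial

namespace SingularH1

variable (Y : Type u) [TopologicalSpace Y]

/-- The coefficient module of singular homology. -/
abbrev coeff : ModuleCat.{u} ℤ := ModuleCat.of ℤ (ULift.{u} ℤ)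

/-- The singular chain complex of `Y`. -/
abbrev chains : ChainComplex (ModuleCat.{u} ℤ) ℕ :=
  (TopCat.toSSet.obj (TopCat.of Y)).chainComplex coeff.{u}

theorem coeff_hom_ext {M : ModuleCat.{u} ℤ} {f g : coeff.{u} ⟶ M}
    (h : f.hom ⟨1⟩ = g.hom ⟨1⟩) : f = g := by
  ext x
  have hx : x = x.down • (⟨1⟩ : ULift.{u} ℤ) := by ext; simp
  rw [hx, map_zsmul, map_zsmul]
  exact congrArg _ h

/-- The morphism from the coefficients sending `1` to `m`. -/
def coeffHom {M : ModuleCat.{u} ℤ} (m : M) : coeff.{u} ⟶ M :=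
  ModuleCat.ofHom ((LinearMap.toSpanSingleton ℤ M m).comp
    (ULift.moduleEquiv (R := ℤ) (M := ℤ)).toLinearMap)

@[simp] theorem coeffHom_one {M : ModuleCat.{u} ℤ} (m : M) : (coeffHom m).hom ⟨1⟩ = m := by
  exact LinearMap.toSpanSingleton_apply_one ℤ M m

variable {Y}

/-- The singular simplex given by a continuous map. -/
def simplex {n : ℕ} (f : C(stdSimplex ℝ (Fin (n + 1)), Y)) :
    (TopCat.toSSet.obj (TopCat.of Y)) _⦋n⦌ :=
  (TopCat.toSSetObjEquiv (TopCat.of Y) (.op ⦋n⦌)).symm f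

theorem exists_simplex {n : ℕ} (s : (TopCat.toSSet.obj (TopCat.of Y)) _⦋n⦌) :
    ∃ f : C(stdSimplex ℝ (Fin (n + 1)), Y), simplex f = s :=
  (TopCat.toSSetObjEquiv (TopCat.of Y) (.op ⦋n⦌)).symm.surjective s

/-- The inclusion of the `i`-th face. -/
def face {n : ℕ} (i : Fin (n + 2)) : C(stdSimplex ℝ (Fin (n + 1)), stdSimplex ℝ (Fin (n + 2))) :=
  ⟨stdSimplex.map i.succAbove, stdSimplex.continuous_map _⟩

theorem δ_simplex {n : ℕ} (f : C(stdSimplex ℝ (Fin (n + 2)), Y)) (i : Fin (n + 2)) :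
    (TopCat.toSSet.obj (TopCat.of Y)).δ i (simplex f) = simplex (f.comp (face i)) := rfl

/-- The chain given by a singular simplex. -/
def chain {n : ℕ} (f : C(stdSimplex ℝ (Fin (n + 1)), Y)) : (chains Y).X n :=
  (SSet.ιChainComplex _ (R := coeff.{u}) (simplex f)).hom ⟨1⟩

theorem d_chain {n : ℕ} (f : C(stdSimplex ℝ (Fin (n + 2)), Y)) :
    ((chains Y).d (n + 1) n).hom (chain f) =
      ∑ i : Fin (n + 2), (-1 : ℤ) ^ i.val • chain (f.comp (face i)) := by
  have := congrArg (fun φ => φ.hom (⟨1⟩ : ULift.{u} ℤ))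
    (SSet.ιChainComplex_d (TopCat.toSSet.obj (TopCat.of Y)) (R := coeff.{u}) (simplex f))
  simp only [ModuleCat.hom_comp, LinearMap.comp_apply, ModuleCat.hom_sum, LinearMap.sum_apply,
    δ_simplex, ModuleCat.hom_zsmul] at this
  exact this

theorem chains_hom_ext {n : ℕ} {M : ModuleCat.{u} ℤ} {φ ψ : (chains Y).X n ⟶ M}
    (h : ∀ f, φ.hom (chain f) = ψ.hom (chain f)) : φ = ψ := by
  apply SSet.chainComplex_hom_ext
  intro s
  obtain ⟨f, rfl⟩ := exists_simplex s
  exact coeff_hom_ext (h f)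

/-- A morphism out of the singular chains, from its values on simplices. -/
def chainsDesc {n : ℕ} {M : ModuleCat.{u} ℤ} (φ : C(stdSimplex ℝ (Fin (n + 1)), Y) → M) :
    (chains Y).X n ⟶ M :=
  (SSet.isColimitChainComplexXCofan (TopCat.toSSet.obj (TopCat.of Y)) coeff.{u} n).desc
    (Limits.Cofan.mk M fun s => coeffHom (φ (TopCat.toSSetObjEquiv (TopCat.of Y) (.op ⦋n⦌) s)))

theorem chainsDesc_chain {n : ℕ} {M : ModuleCat.{u} ℤ}
    (φ : C(stdSimplex ℝ (Fin (n + 1)), Y) → M) (f : C(stdSimplex ℝ (Fin (n + 1)), Y)) :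
    (chainsDesc φ).hom (chain f) = φ f := by
  have := (SSet.isColimitChainComplexXCofan (TopCat.toSSet.obj (TopCat.of Y)) coeff.{u} n).fac
    (Limits.Cofan.mk M fun s => coeffHom (φ (TopCat.toSSetObjEquiv (TopCat.of Y) (.op ⦋n⦌) s)))
    ⟨simplex f⟩
  have := congrArg (fun φ => φ.hom (⟨1⟩ : ULift.{u} ℤ)) this
  refine this.trans ((coeffHom_one _).trans ?_)
  simp [simplex]

variable (Y) in
/-- One-chains modulo boundaries. -/
abbrev Opcycles : ModuleCat.{u} ℤ := (chains Y).opcycles 1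

/-- The class of a singular one-simplex modulo boundaries. -/
def edge (f : C(stdSimplex ℝ (Fin 2), Y)) : Opcycles Y := ((chains Y).pOpcycles 1).hom (chain f)

theorem edge_boundary (F : C(stdSimplex ℝ (Fin 3), Y)) :
    edge (F.comp (face 0)) + edge (F.comp (face 2)) = edge (F.comp (face 1)) := by
  have h := congrArg (fun φ => φ.hom (chain F)) ((chains Y).d_pOpcycles 2 1)
  simp only [ModuleCat.hom_comp, LinearMap.comp_apply, d_chain] at h
  simp [Fin.sum_univ_three, map_add, -stdSimplex.map_coe] at h
  simp only [edge]
  rw [← sub_eq_zero, ← h]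
  abel

/-- The parametrization of the standard one-simplex by the unit interval. -/
def coord : C(stdSimplex ℝ (Fin 2), I) := ⟨_, stdSimplexHomeomorphUnitInterval.continuous⟩

theorem coord_apply (x : stdSimplex ℝ (Fin 2)) : (coord x : ℝ) = x 1 := rfl

/-- The class of a path modulo boundaries. -/
def pathClass {p q : Y} (γ : Path p q) : Opcycles Y := edge (γ.toContinuousMap.comp coord)

theorem pathClass_boundary {a b c : Y} (α : Path a b) (β : Path b c) (γ : Path a c)
    (F : C(stdSimplex ℝ (Fin 3), Y)) (h0 : ∀ x, F (face 0 x) = β (coord x))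
    (h1 : ∀ x, F (face 1 x) = γ (coord x)) (h2 : ∀ x, F (face 2 x) = α (coord x)) :
    pathClass β + pathClass α = pathClass γ := by
  have e0 : β.toContinuousMap.comp coord = F.comp (face 0) := ContinuousMap.ext fun x => (h0 x).symm
  have e1 : γ.toContinuousMap.comp coord = F.comp (face 1) := ContinuousMap.ext fun x => (h1 x).symm
  have e2 : α.toContinuousMap.comp coord = F.comp (face 2) := ContinuousMap.ext fun x => (h2 x).symm
  unfold pathClass
  rw [e0, e1, e2]
  exact edge_boundary F

end SingularH1

end

/-! ### Additivity and homotopy invariance of path classes. -/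

noncomputable section

open Topology unitInterval Set CategoryTheory Simplicial

namespace SingularH1

theorem face_self {n : ℕ} (i : Fin (n + 2)) (x : stdSimplex ℝ (Fin (n + 1))) :
    face i x i = 0 := by
  simp only [face, ContinuousMap.coe_mk, stdSimplex.map_coe, FunOnFinite.linearMap_apply_apply]
  exact Finset.sum_eq_zero fun k hk => (Fin.succAbove_ne i k (by simp at hk)).elim

theorem face_succAbove {n : ℕ} (i : Fin (n + 2)) (x : stdSimplex ℝ (Fin (n + 1)))
    (k : Fin (n + 1)) : face i x (i.succAbove k) = x k := by
  simp only [face, ContinuousMap.coe_mk, stdSimplex.map_coe, FunOnFinite.linearMap_apply_apply]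
  have : (Finset.univ.filter fun l => i.succAbove l = i.succAbove k) = {k} := by
    ext l; simp
  rw [this, Finset.sum_singleton]

/-- The affine map from the triangle to the unit interval with given values at the vertices. -/
def triangle (a b c : I) : C(stdSimplex ℝ (Fin 3), I) :=
  ⟨fun x => ⟨x 0 * a + x 1 * b + x 2 * c, by
    have h : x 0 + x 1 + x 2 = 1 := by rw [← Fin.sum_univ_three]; exact stdSimplex.sum_eq_one x
    have h0 := stdSimplex.zero_le x 0
    have h1 := stdSimplex.zero_le x 1
    have h2 := stdSimplex.zero_le x 2
    exact (convex_Icc (0 : ℝ) 1).sum_mem (t := Finset.univ) (w := x) (z := ![(a : ℝ), b, c])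
      (fun i _ => stdSimplex.zero_le x i) (stdSimplex.sum_eq_one x)
      (fun i _ => by fin_cases i; exacts [a.2, b.2, c.2]) |> fun h => by
        simpa [Fin.sum_univ_three, -Set.mem_Icc] using h⟩, by
    have hc : ∀ j, Continuous fun x : stdSimplex ℝ (Fin 3) => x j := fun j =>
      (continuous_apply j).comp continuous_subtype_val
    exact Continuous.subtype_mk (((hc 0).mul_const _).add ((hc 1).mul_const _) |>.add
      ((hc 2).mul_const _)) _⟩

theorem triangle_face_zero (a b c : I) (x : stdSimplex ℝ (Fin 2)) :
    (triangle a b c (face 0 x) : ℝ) = (1 - coord x) * b + coord x * c := by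
  have h0 : face 0 x 0 = 0 := face_self 0 x
  have h1 : face 0 x 1 = x 0 := face_succAbove 0 x 0
  have h2 : face 0 x 2 = x 1 := face_succAbove 0 x 1
  have h := stdSimplex.add_eq_one x
  simp only [triangle, ContinuousMap.coe_mk, h0, h1, h2, coord_apply]
  rw [← h]; ring

theorem triangle_face_one (a b c : I) (x : stdSimplex ℝ (Fin 2)) :
    (triangle a b c (face 1 x) : ℝ) = (1 - coord x) * a + coord x * c := by
  have h0 : face 1 x 1 = 0 := face_self 1 x
  have h1 : face 1 x 0 = x 0 := face_succAbove 1 x 0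
  have h2 : face 1 x 2 = x 1 := face_succAbove 1 x 1
  have h := stdSimplex.add_eq_one x
  simp only [triangle, ContinuousMap.coe_mk, h0, h1, h2, coord_apply]
  rw [← h]; ring

theorem triangle_face_two (a b c : I) (x : stdSimplex ℝ (Fin 2)) :
    (triangle a b c (face 2 x) : ℝ) = (1 - coord x) * a + coord x * b := by
  have h0 : face 2 x 2 = 0 := face_self 2 x
  have h1 : face 2 x 0 = x 0 := face_succAbove 2 x 0
  have h2 : face 2 x 1 = x 1 := face_succAbove 2 x 1
  have h := stdSimplex.add_eq_one x
  simp only [triangle, ContinuousMap.coe_mk, h0, h1, h2, coord_apply]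
  rw [← h]; ring

variable {Y : Type u} [TopologicalSpace Y]

theorem pathClass_refl (p : Y) : pathClass (Path.refl p) = 0 := by
  have := pathClass_boundary (Path.refl p) (Path.refl p) (Path.refl p) (.const _ p)
    (fun _ => rfl) (fun _ => rfl) (fun _ => rfl)
  simpa using this

theorem pathClass_trans {a b c : Y} (α : Path a b) (β : Path b c) :
    pathClass (α.trans β) = pathClass β + pathClass α := by
  -- The singular triangle is the concatenated path composed with the affine map sending the
  -- vertices to 0, 1/2 and 1; two of its edges trace the two halves.
  let h : I := ⟨1 / 2, by norm_num, by norm_num⟩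
  refine (pathClass_boundary α β (α.trans β)
    ((α.trans β).toContinuousMap.comp (triangle 0 h 1)) ?_ ?_ ?_).symm
  · intro x
    have e : (triangle 0 h 1 (face 0 x) : ℝ) = (1 + coord x) / 2 := by
      rw [triangle_face_zero]; simp only [h, Icc.coe_one]; ring
    have hx := (coord x).2.1
    simp only [ContinuousMap.comp_apply, Path.coe_toContinuousMap, Path.trans_apply]
    split_ifs with h'
    · rw [e] at h'
      have h0 : (coord x : ℝ) = 0 := by linarith
      have h1 : coord x = 0 := Subtype.ext h0
      have : (⟨2 * (triangle 0 h 1 (face 0 x) : ℝ), by rw [e, h0]; norm_num⟩ : I) = 1 :=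
        Subtype.ext (by simp only [e, h0]; norm_num)
      rw [h1, β.source]
      exact (congrArg α this).trans α.target
    · congr 1; ext; simp only [e]; ring
  · intro x
    have e : triangle 0 h 1 (face 1 x) = coord x := by
      ext; rw [triangle_face_one]; simp
    simp only [ContinuousMap.comp_apply, e]
    rfl
  · intro x
    have e : (triangle 0 h 1 (face 2 x) : ℝ) = coord x / 2 := by
      rw [triangle_face_two]; simp only [h, Icc.coe_zero]; ring
    have hx := (coord x).2.2
    simp only [ContinuousMap.comp_apply, Path.coe_toContinuousMap, Path.trans_apply]
    split_ifs with h'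
    · congr 1; ext; simp only [e]; ring
    · exact (h' (by rw [e]; linarith)).elim

theorem pathClass_homotopic {a b : Y} {α β : Path a b} (h : α.Homotopic β) :
    pathClass α = pathClass β := by
  obtain ⟨F⟩ := h
  -- The square of the homotopy is cut along its diagonal into two singular triangles, each with one
  -- constant edge.
  let diag : Path a b := ⟨⟨fun t => F (t, t), by fun_prop⟩, by simp, by simp⟩
  have h1 : pathClass (Path.refl b) + pathClass α = pathClass diag := by
    refine pathClass_boundary α (Path.refl b) diag
      (F.toContinuousMap.comp ((triangle 0 0 1).prodMk (triangle 0 1 1))) ?_ ?_ ?_ <;> intro x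
    · have : triangle 0 1 1 (face 0 x) = 1 := by ext; rw [triangle_face_zero]; simp
      simp [this]
    · have e1 : triangle 0 1 1 (face 1 x) = coord x := by ext; rw [triangle_face_one]; simp
      have e2 : triangle 0 0 1 (face 1 x) = coord x := by ext; rw [triangle_face_one]; simp
      simp [e1, e2, diag]
    · have e1 : triangle 0 1 1 (face 2 x) = coord x := by ext; rw [triangle_face_two]; simp
      have e2 : triangle 0 0 1 (face 2 x) = 0 := by ext; rw [triangle_face_two]; simp
      simp [e1, e2]
  have h2 : pathClass β + pathClass (Path.refl a) = pathClass diag := by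
    refine pathClass_boundary (Path.refl a) β diag
      (F.toContinuousMap.comp ((triangle 0 1 1).prodMk (triangle 0 0 1))) ?_ ?_ ?_ <;> intro x
    · have e1 : triangle 0 1 1 (face 0 x) = 1 := by ext; rw [triangle_face_zero]; simp
      have e2 : triangle 0 0 1 (face 0 x) = coord x := by ext; rw [triangle_face_zero]; simp
      simp [e1, e2]
    · have e1 : triangle 0 1 1 (face 1 x) = coord x := by ext; rw [triangle_face_one]; simp
      have e2 : triangle 0 0 1 (face 1 x) = coord x := by ext; rw [triangle_face_one]; simp
      simp [e1, e2, diag]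
    · have : triangle 0 0 1 (face 2 x) = 0 := by ext; rw [triangle_face_two]; simp
      simp [this]
  rw [pathClass_refl] at h1 h2
  rw [← zero_add (pathClass α), h1, ← h2, add_zero]

end SingularH1

end

/-! ### The Hurewicz homomorphism and the periods of circle-valued maps. -/

noncomputable section

open Topology unitInterval Set CategoryTheory Simplicial

theorem Convex.simplyConnectedSpace {E : Type*} [NormedAddCommGroup E] [NormedSpace ℝ E]
    {s : Set E} (hs : Convex ℝ s) (hne : s.Nonempty) : SimplyConnectedSpace s :=
  have := hs.contractibleSpace hne
  inferInstance

namespace AddCircle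

theorem exists_lift {A : Type*} [TopologicalSpace A] [SimplyConnectedSpace A]
    [LocallyPathConnectedSpace A] (f : C(A, AddCircle (1 : ℝ))) :
    ∃ L : C(A, ℝ), ∀ a, (L a : AddCircle (1 : ℝ)) = f a := by
  obtain ⟨a₀⟩ : Nonempty A := inferInstance
  obtain ⟨L, ⟨-, hL⟩, -⟩ := (AddCircle.isCoveringMap_coe (1 : ℝ)).existsUnique_continuousMap_lifts
    f a₀ _ (Quotient.out_eq' (f a₀))
  exact ⟨L, fun a => congrFun hL a⟩

end AddCircle

namespace SingularH1

/-- A subgroup as a submodule for any `ℤ`-module structure. -/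
def intSubmodule {M : Type*} [AddCommGroup M] [Module ℤ M] (S : AddSubgroup M) : Submodule ℤ M :=
  { S with
    smul_mem' := fun n x hx => by
      have h := int_smul_eq_zsmul ‹Module ℤ M› n x
      exact (congrArg (· ∈ S) h).mpr (S.zsmul_mem hx n) }

variable {Y : Type u} [TopologicalSpace Y]

theorem pathClass_symm {p q : Y} (γ : Path p q) : pathClass γ.symm = -pathClass γ := by
  have h : pathClass (γ.trans γ.symm) = 0 := by
    rw [← pathClass_refl p]
    exact pathClass_homotopic ⟨(Path.Homotopy.reflTransSymm γ).symm⟩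
  rw [pathClass_trans] at h
  exact eq_neg_of_add_eq_zero_left h

theorem coord_face_zero (x : stdSimplex ℝ (Fin 1)) : coord (face 0 x) = 1 := by
  ext
  have : face 0 x 1 = x 0 := face_succAbove 0 x 0
  rw [coord_apply, this, stdSimplex.eq_one_of_unique]; rfl

theorem coord_face_one (x : stdSimplex ℝ (Fin 1)) : coord (face 1 x) = 0 := by
  ext
  have : face 1 x 1 = 0 := face_self 1 x
  rw [coord_apply, this]; rfl

/-- The zero-chain given by a point. -/
def pointChain (p : Y) : (chains Y).X 0 := chain (.const _ p)

theorem d_chain_path {p q : Y} (γ : Path p q) :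
    ((chains Y).d 1 0).hom (chain (γ.toContinuousMap.comp coord)) = pointChain q - pointChain p := by
  have h0 : (γ.toContinuousMap.comp coord).comp (face 0) = .const _ q := by
    ext x; simp [coord_face_zero]
  have h1 : (γ.toContinuousMap.comp coord).comp (face 1) = .const _ p := by
    ext x; simp [coord_face_one]
  rw [d_chain, Fin.sum_univ_two, h0, h1]
  simp [pointChain, sub_eq_add_neg]

theorem fromOpcycles_pathClass {p q : Y} (γ : Path p q) :
    ((chains Y).fromOpcycles 1 0).hom (pathClass γ) = pointChain q - pointChain p := by
  rw [← d_chain_path, pathClass, edge, ← LinearMap.comp_apply, ← ModuleCat.hom_comp,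
    HomologicalComplex.p_fromOpcycles]

variable (Y) in
/-- The inclusion of the first homology into the one-chains modulo boundaries. -/
def toOpcycles : SingularH1 Y →ₗ[ℤ] Opcycles Y := ((chains Y).homologyι 1).hom

theorem toOpcycles_injective : Function.Injective (toOpcycles Y) :=
  (ModuleCat.mono_iff_injective _).1 (inferInstanceAs (Mono ((chains Y).homologyι 1)))

theorem exists_toOpcycles_eq {w : Opcycles Y} (hw : ((chains Y).fromOpcycles 1 0).hom w = 0) :
    ∃ z, toOpcycles Y z = w := by
  have h : coeffHom w ≫ (chains Y).fromOpcycles 1 0 = 0 :=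
    coeff_hom_ext (by
      rw [ModuleCat.hom_comp, LinearMap.comp_apply, coeffHom_one, hw]; rfl)
  have hk := (chains Y).homologyIsKernel 1 0 (by simp)
  refine ⟨(hk.lift (Limits.KernelFork.ofι _ h)).hom ⟨1⟩, ?_⟩
  have := congrArg (fun φ => φ.hom (⟨1⟩ : ULift.{u} ℤ))
    (hk.fac (Limits.KernelFork.ofι _ h) .zero)
  exact this.trans (coeffHom_one w)

theorem fromOpcycles_toOpcycles (z : SingularH1 Y) :
    ((chains Y).fromOpcycles 1 0).hom (toOpcycles Y z) = 0 :=
  congrArg (fun φ => φ.hom z) ((chains Y).homologyι_comp_fromOpcycles 1 0)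

theorem exists_loopClass {y : Y} (g : FundamentalGroup Y y) :
    ∃ z : SingularH1 Y, ∀ γ : Path y y, FundamentalGroup.fromPath (.mk γ) = g →
      toOpcycles Y z = pathClass γ := by
  obtain ⟨δ, rfl⟩ := Path.Homotopic.Quotient.mk_surjective g
  obtain ⟨z, hz⟩ := exists_toOpcycles_eq (w := pathClass δ)
    (by rw [fromOpcycles_pathClass, sub_self])
  exact ⟨z, fun γ h => hz.trans
    (pathClass_homotopic (Path.Homotopic.Quotient.exact h)).symm⟩

/-- The homology class of a loop. -/
def loopClass {y : Y} (g : FundamentalGroup Y y) : SingularH1 Y := (exists_loopClass g).choose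

theorem toOpcycles_loopClass {y : Y} (γ : Path y y) :
    toOpcycles Y (loopClass (FundamentalGroup.fromPath (.mk γ))) = pathClass γ :=
  (exists_loopClass _).choose_spec γ rfl

/-- The Hurewicz homomorphism. -/
def hurewicz (y : Y) : FundamentalGroup Y y →* Multiplicative (SingularH1 Y) :=
  MonoidHom.mk' (fun g => .ofAdd (loopClass g)) fun g h => by
    obtain ⟨γ, rfl⟩ := Path.Homotopic.Quotient.mk_surjective g
    obtain ⟨δ, rfl⟩ := Path.Homotopic.Quotient.mk_surjective h
    rw [FundamentalGroup.mul_def, ← Path.Homotopic.Quotient.mk_trans, ← ofAdd_add]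
    congr 1
    apply toOpcycles_injective
    rw [map_add]
    refine (toOpcycles_loopClass _).trans ?_
    rw [pathClass_trans]
    exact congrArg₂ _ (toOpcycles_loopClass _).symm (toOpcycles_loopClass _).symm

theorem toOpcycles_hurewicz {y : Y} (γ : Path y y) :
    toOpcycles Y (hurewicz y (FundamentalGroup.fromPath (.mk γ))).toAdd = pathClass γ :=
  toOpcycles_loopClass γ

/-- The path traced by a singular one-simplex. -/
def simplexPath (f : C(stdSimplex ℝ (Fin 2), Y)) :
    Path (f (stdSimplexHomeomorphUnitInterval.symm 0))
      (f (stdSimplexHomeomorphUnitInterval.symm 1)) :=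
  ⟨f.comp ⟨_, stdSimplexHomeomorphUnitInterval.symm.continuous⟩, rfl, rfl⟩

theorem simplexPath_comp_coord (f : C(stdSimplex ℝ (Fin 2), Y)) :
    (simplexPath f).toContinuousMap.comp coord = f := by
  ext x
  change f (stdSimplexHomeomorphUnitInterval.symm (stdSimplexHomeomorphUnitInterval x)) = f x
  rw [Homeomorph.symm_apply_apply]

theorem hurewicz_surjective [PathConnectedSpace Y] (y : Y) :
    Function.Surjective (hurewicz y) := by
  let c := fun p => PathConnectedSpace.somePath y p
  let loop : C(stdSimplex ℝ (Fin 2), Y) → Path y y := fun f =>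
    ((c _).trans (simplexPath f)).trans (c _).symm
  let T : (chains Y).X 1 ⟶ (chains Y).homology 1 :=
    chainsDesc (M := (chains Y).homology 1) fun f => (hurewicz y (FundamentalGroup.fromPath (.mk (loop f)))).toAdd
  let B : (chains Y).X 0 ⟶ Opcycles Y := chainsDesc fun f => pathClass (c (f default))
  have hB : ∀ p, B.hom (pointChain p) = pathClass (c p) := fun p => chainsDesc_chain _ _
  -- Closing a simplex up to a loop adds the connecting paths of its end points, which are a
  -- function of its boundary. On cycles this correction vanishes, so `T` computes the homology
  -- class.
  have key : (chains Y).pOpcycles 1 =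
      T ≫ (chains Y).homologyι 1 + (chains Y).d 1 0 ≫ B := by
    apply chains_hom_ext
    intro f
    have h1 : T.hom (chain f) = (hurewicz y (FundamentalGroup.fromPath (.mk (loop f)))).toAdd :=
      chainsDesc_chain _ _
    have h2 := d_chain_path (simplexPath f)
    rw [simplexPath_comp_coord] at h2
    have h3 : pathClass (simplexPath f) = ((chains Y).pOpcycles 1).hom (chain f) := by
      rw [pathClass, simplexPath_comp_coord]; rfl
    simp only [ModuleCat.hom_add, ModuleCat.hom_comp, LinearMap.add_apply, LinearMap.comp_apply]
    rw [h1, h2]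
    change _ = toOpcycles Y _ + _
    rw [toOpcycles_hurewicz, map_sub, hB, hB, ← h3]
    simp only [loop, pathClass_trans, pathClass_symm]
    abel
  intro z
  obtain ⟨k, hk⟩ := (ModuleCat.epi_iff_surjective ((chains Y).pOpcycles 1)).1 inferInstance
    (toOpcycles Y z.toAdd)
  have hd : ((chains Y).d 1 0).hom k = 0 := by
    rw [← HomologicalComplex.p_fromOpcycles, ModuleCat.hom_comp, LinearMap.comp_apply]
    erw [hk]
    exact fromOpcycles_toOpcycles _
  have hT : T.hom k = z.toAdd := by
    apply toOpcycles_injective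
    have h := congrArg (fun φ => φ.hom k) key
    simp only [ModuleCat.hom_add, ModuleCat.hom_comp, LinearMap.add_apply, LinearMap.comp_apply,
      hd, map_zero, add_zero] at h
    exact h.symm.trans hk
  -- `T` takes Hurewicz images as values on simplices, hence lands in their subgroup on all chains.
  let N : Submodule ℤ ((chains Y).homology 1) :=
    intSubmodule (Subgroup.toAddSubgroup' (hurewicz y).range)
  let π := @ModuleCat.ofHom ℤ _ _ _ _ _ _ (Submodule.Quotient.module N) N.mkQ
  have hN : T ≫ π = 0 := by
    apply chains_hom_ext
    intro f
    have h1 : T.hom (chain f) = (hurewicz y (FundamentalGroup.fromPath (.mk (loop f)))).toAdd :=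
      chainsDesc_chain _ _
    rw [ModuleCat.hom_comp, LinearMap.comp_apply, h1]
    exact (Submodule.Quotient.mk_eq_zero N).2 ⟨_, rfl⟩
  have := congrArg (fun φ => φ.hom k) hN
  simp only [ModuleCat.hom_comp, LinearMap.comp_apply] at this
  rw [hT] at this
  exact (Submodule.Quotient.mk_eq_zero N).1 this

/-- A map to the circle `ℝ / ℤ` induces a real-valued homomorphism on the first homology. -/
theorem exists_hom_of_circleMap (f : C(Y, AddCircle (1 : ℝ))) :
    ∃ ev : SingularH1 Y →+ ℝ, ∀ (y : Y) (γ : Path y y),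
      ev (hurewicz y (FundamentalGroup.fromPath (.mk γ))).toAdd =
        AddCircle.liftDiff (f.comp γ.toContinuousMap) := by
  -- The increment of a real lift along a simplex is a cocycle: over a triangle there is one lift on
  -- all three edges, and its increments telescope.
  let W : (chains Y).X 1 ⟶ ModuleCat.of ℤ (ULift.{u} ℝ) := chainsDesc fun g =>
    ⟨AddCircle.liftDiff (f.comp (simplexPath g).toContinuousMap)⟩
  have hW : (chains Y).d 2 1 ≫ W = 0 := by
    apply chains_hom_ext
    intro F
    have : SimplyConnectedSpace (stdSimplex ℝ (Fin 3)) :=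
      (convex_stdSimplex ℝ (Fin 3)).simplyConnectedSpace ⟨_, single_mem_stdSimplex ℝ 0⟩
    have := (convex_stdSimplex ℝ (Fin 3)).locallyPathConnectedSpace
    obtain ⟨L, hL⟩ := AddCircle.exists_lift (f.comp F)
    have e : ∀ i, W.hom (chain (F.comp (face i))) =
        ⟨L (face i (stdSimplexHomeomorphUnitInterval.symm 1)) -
          L (face i (stdSimplexHomeomorphUnitInterval.symm 0))⟩ := by
      intro i
      refine (chainsDesc_chain _ _).trans (congrArg ULift.up ?_)
      exact AddCircle.liftDiff_eq
        (L := fun t => L (face i (stdSimplexHomeomorphUnitInterval.symm t)))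
        (by fun_prop) fun t => hL _
    have v0 : stdSimplexHomeomorphUnitInterval.symm 0 = stdSimplex.vertex 0 := by
      rw [Homeomorph.symm_apply_eq]; rfl
    have v1 : stdSimplexHomeomorphUnitInterval.symm 1 = stdSimplex.vertex 1 := by
      rw [Homeomorph.symm_apply_eq]; rfl
    have hv : ∀ (i : Fin 3) (k : Fin 2), face i (stdSimplex.vertex k) =
      stdSimplex.vertex (i.succAbove k) := fun i k => stdSimplex.map_vertex _ _
    simp only [ModuleCat.hom_comp, LinearMap.comp_apply, d_chain, map_sum, map_zsmul, e, v0, v1, hv]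
    ext
    simp [Fin.sum_univ_three, Fin.succAbove]
  let ev := (chains Y).homologyι 1 ≫ (chains Y).descOpcycles W 2 (by simp) hW
  refine ⟨AddEquiv.ulift.toAddMonoidHom.comp ev.hom.toAddMonoidHom, fun y γ => ?_⟩
  have h1 : ((chains Y).homologyι 1).hom
    (hurewicz y (FundamentalGroup.fromPath (.mk γ))).toAdd = pathClass γ := toOpcycles_hurewicz γ
  have h2 : ((chains Y).descOpcycles W 2 (by simp) hW).hom (pathClass γ) =
      W.hom (chain (γ.toContinuousMap.comp coord)) :=
    congrArg (fun φ => φ.hom (chain (γ.toContinuousMap.comp coord)))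
      ((chains Y).p_descOpcycles W 2 (by simp) hW)
  have h3 : ev.hom (hurewicz y (FundamentalGroup.fromPath (.mk γ))).toAdd =
      W.hom (chain (γ.toContinuousMap.comp coord)) := by
    rw [← h2, ← h1]; rfl
  change (ev.hom (hurewicz y (FundamentalGroup.fromPath (.mk γ))).toAdd).down = _
  rw [h3]
  refine (congrArg ULift.down (chainsDesc_chain _ _)).trans ?_
  congr 1

end SingularH1

end

/-! ### Handlebodies and transport inside them. -/

noncomputable section

open Topology unitInterval Set

instance : SimplyConnectedSpace Ball3 :=
  (convex_closedBall _ _).simplyConnectedSpace ⟨0, by simp⟩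

instance : LocallyPathConnectedSpace Ball3 := (convex_closedBall _ _).locallyPathConnectedSpace

instance : SimplyConnectedSpace (Metric.closedBall (0 : ℂ) 1) :=
  (convex_closedBall _ _).simplyConnectedSpace ⟨0, by simp⟩

instance : SimplyConnectedSpace Handle3 :=
  have : ContractibleSpace (Metric.closedBall (0 : ℂ) 1) :=
    (convex_closedBall _ _).contractibleSpace ⟨0, by simp⟩
  have : ContractibleSpace (Icc (-1 : ℝ) 1) := (convex_Icc _ _).contractibleSpace ⟨0, by simp⟩
  inferInstance

instance : LocallyPathConnectedSpace Handle3 :=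
  have : LocallyPathConnectedSpace (Metric.closedBall (0 : ℂ) 1) :=
    (convex_closedBall _ _).locallyPathConnectedSpace
  have : LocallyPathConnectedSpace (Icc (-1 : ℝ) 1) := (convex_Icc _ _).locallyPathConnectedSpace
  inferInstance

/-- The center of the unit ball. -/
def Ball3.center : Ball3 := ⟨0, by simp⟩

/-- The point `(0, t)` on the axis of the standard handle. -/
def Handle3.axis (t : Icc (-1 : ℝ) 1) : Handle3 := (⟨0, by simp⟩, t)

/-- The upper end of the axis. -/
def Handle3.top : Icc (-1 : ℝ) 1 := ⟨1, by simp⟩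

/-- The lower end of the axis. -/
def Handle3.bot : Icc (-1 : ℝ) 1 := ⟨-1, by simp⟩

/-- The middle of the axis. -/
def Handle3.mid : Icc (-1 : ℝ) 1 := ⟨0, by simp⟩

/-- The two end discs of the standard handle. -/
def Handle3.ends : Set Handle3 := {p | |(p.2 : ℝ)| = 1}

/-- A ball with `g` disjoint one-handles in a space. -/
structure Handlebody (g : ℕ) (X : Type*) [TopologicalSpace X] where
  b : Ball3 → X
  h : Fin g → Handle3 → X
  isEmbedding_b : IsEmbedding b
  isEmbedding_h : ∀ i, IsEmbedding (h i)
  disjoint : Pairwise fun i j => Disjoint (range (h i)) (range (h j))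
  inter : ∀ i, range (h i) ∩ range b = h i '' Handle3.ends
  ends_subset : ∀ i, h i '' Handle3.ends ⊆ b '' {x | ‖(x : EuclideanSpace ℝ (Fin 3))‖ = 1}

namespace Holonomy

variable {X : Type*} [TopologicalSpace X] {Γ : Type*} [Group Γ] {H : Holonomy X Γ}
  {M : Type*} [MulAction Γ M]

theorem LocFlat.mono {s : X → M} {F F' : Set X} (h : H.LocFlat s F) (hF : F' ⊆ F) :
    H.LocFlat s F' := fun p hp =>
  let ⟨N, hN, h⟩ := h p (hF hp)
  ⟨N, hN, fun q hq => h q ⟨hq.1, hF hq.2⟩⟩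

theorem LocFlat.image {C : Type*} [TopologicalSpace C] [SimplyConnectedSpace C]
    [LocallyPathConnectedSpace C] {j : C → X} (hj : IsEmbedding j) {s : X → M} {A : Set C}
    (h : ∀ c ∈ A, ∀ d ∈ A, s (j d) = (H.pullback hj.continuous).tr c d • s (j c)) :
    H.LocFlat s (j '' A) := by
  rcases A.eq_empty_or_nonempty with rfl | ⟨c₀, h₀⟩
  · rw [image_empty]; exact fun p hp => hp.elim
  let s' : X → M :=
    Function.extend j (fun d => (H.pullback hj.continuous).tr c₀ d • s (j c₀)) s
  have hs' : ∀ d, s' (j d) = (H.pullback hj.continuous).tr c₀ d • s (j c₀) := fun d =>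
    hj.injective.extend_apply _ _ d
  refine ((LocFlat.of_range hj (s := s') fun c d δ => ?_).mono (image_subset_range j A)).congr ?_
  · rw [hs', hs', smul_smul, ← H.pullback_hol, hol_eq_tr, tr_mul_tr]
  · rintro _ ⟨d, hd, rfl⟩
    rw [hs', h c₀ h₀ d hd]

end Holonomy

namespace Handlebody

open Handle3

variable {g : ℕ} {X : Type*} [TopologicalSpace X] (D : Handlebody g X)

/-- The subset occupied by the handlebody. -/
def carrier : Set X := range D.b ∪ ⋃ i, range (D.h i)

/-- The core disc of a handle. -/
def core (i : Fin g) : Set X := D.h i '' {p | (p.2 : ℝ) = 0}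

variable {D}

theorem h_mem_range_b {i : Fin g} {c : Handle3} : D.h i c ∈ range D.b ↔ |(c.2 : ℝ)| = 1 := by
  constructor
  · intro hc
    have : D.h i c ∈ D.h i '' ends := by rw [← D.inter]; exact ⟨⟨c, rfl⟩, hc⟩
    obtain ⟨c', hc', he⟩ := this
    rwa [← (D.isEmbedding_h i).injective he]
  · intro hc
    have : D.h i c ∈ D.h i '' ends := ⟨c, hc, rfl⟩
    rw [← D.inter] at this
    exact this.2

theorem h_inj {i k : Fin g} {c d : Handle3} (he : D.h i c = D.h k d) : i = k ∧ c = d := by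
  obtain rfl : i = k := by
    by_contra hik
    exact disjoint_left.1 (D.disjoint hik) ⟨c, rfl⟩ ⟨d, he.symm⟩
  exact ⟨rfl, (D.isEmbedding_h i).injective he⟩

theorem h_mem_core {i k : Fin g} {c : Handle3} : D.h i c ∈ D.core k ↔ i = k ∧ (c.2 : ℝ) = 0 := by
  constructor
  · rintro ⟨d, hd, he⟩
    obtain ⟨rfl, rfl⟩ := h_inj he
    exact ⟨rfl, hd⟩
  · rintro ⟨rfl, hc⟩
    exact ⟨c, hc, rfl⟩

theorem b_notMem_core {i : Fin g} {d : Ball3} : D.b d ∉ D.core i := by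
  rintro ⟨c, hc, he⟩
  have : D.h i c ∈ range D.b := ⟨d, he.symm⟩
  rw [h_mem_range_b, hc] at this
  simp at this

variable (D) in
theorem isClosed_core [T2Space X] (i : Fin g) : IsClosed (D.core i) := by
  have : IsClosed {p : Handle3 | (p.2 : ℝ) = 0} :=
    isClosed_eq (by fun_prop) continuous_const
  exact (this.isCompact.image (D.isEmbedding_h i).continuous).isClosed

variable (D) in
/-- The center in the ball of an attaching disc. -/
theorem exists_foot (i : Fin g) (ε : Icc (-1 : ℝ) 1) :
    ∃ a : Ball3, |(ε : ℝ)| = 1 → D.b a = D.h i (axis ε) := by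
  by_cases hε : |(ε : ℝ)| = 1
  · obtain ⟨a, ha⟩ := (h_mem_range_b (D := D) (i := i) (c := axis ε)).2 hε
    exact ⟨a, fun _ => ha⟩
  · exact ⟨Ball3.center, fun h => (hε h).elim⟩

variable (D) in
/-- The point of the ball to which the center of an end disc is attached. -/
def foot (i : Fin g) (ε : Icc (-1 : ℝ) 1) : Ball3 := (D.exists_foot i ε).choose

theorem b_foot {i : Fin g} {ε : Icc (-1 : ℝ) 1} (hε : |(ε : ℝ)| = 1) :
    D.b (D.foot i ε) = D.h i (axis ε) := (D.exists_foot i ε).choose_spec hε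

variable {Γ : Type*} [Group Γ] (H : Holonomy X Γ)

variable (D) in
/-- Transport in the ball. -/
def trB (c d : Ball3) : Γ := (H.pullback D.isEmbedding_b.continuous).tr c d

variable (D) in
/-- Transport in a handle. -/
def trH (i : Fin g) (c d : Handle3) : Γ := (H.pullback (D.isEmbedding_h i).continuous).tr c d

variable {H}

theorem trB_mul (p q r : Ball3) : D.trB H q r * D.trB H p q = D.trB H p r := Holonomy.tr_mul_tr ..

theorem trH_mul (i : Fin g) (p q r : Handle3) :
    D.trH H i q r * D.trH H i p q = D.trH H i p r := Holonomy.tr_mul_tr ..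

/-- An end disc lies in both the ball and the handle, so a path of constant height computes both
transports. -/
theorem trB_eq_trH {i : Fin g} {c d : Handle3} (hcd : c.2 = d.2) {p q : Ball3}
    (hp : D.b p = D.h i c) (hq : D.b q = D.h i d) : D.trB H p q = D.trH H i c d := by
  obtain ⟨c, ε⟩ := c
  obtain ⟨d, ε'⟩ := d
  obtain rfl : ε = ε' := hcd
  have hε : |(ε : ℝ)| = 1 := (h_mem_range_b (D := D) (i := i) (c := (c, ε))).1 ⟨p, hp⟩
  let δ : Path (c, ε) (d, ε) := (PathConnectedSpace.somePath c d).prod (Path.refl ε)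
  have h1 : (H.pullback (D.isEmbedding_h i).continuous).hol δ = D.trH H i (c, ε) (d, ε) :=
    Holonomy.hol_eq_tr _ δ
  rw [← h1, H.pullback_hol]
  refine (H.hol_eq_tr_of_range_subset D.isEmbedding_b _ hp.symm hq.symm ?_).symm
  rintro _ ⟨t, rfl⟩
  exact h_mem_range_b.2 hε

variable (D) (H)

/-- The transport from the center of the ball to a point of a handle, entering the handle through
the end disc of height `ε`. -/
def side (ε : Icc (-1 : ℝ) 1) (i : Fin g) (c : Handle3) : Γ :=
  D.trH H i (axis ε) c * D.trB H Ball3.center (D.foot i ε)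

/-- The transport along the loop through a handle. -/
def gen (i : Fin g) : Γ := (D.side H bot i (axis mid))⁻¹ * D.side H top i (axis mid)

variable {D} {H}

theorem trH_mul_side (ε : Icc (-1 : ℝ) 1) (i : Fin g) (c d : Handle3) :
    D.trH H i c d * D.side H ε i c = D.side H ε i d := by
  rw [side, side, ← mul_assoc, trH_mul]

/-- Changing the side of entry is right multiplication by the generator: each crossing of a core
therefore contributes one letter. -/
theorem side_top (i : Fin g) (c : Handle3) : D.side H top i c = D.side H bot i c * D.gen H i := by
  rw [← trH_mul_side top i (axis mid) c, ← trH_mul_side bot i (axis mid) c, gen]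
  group

/-- Compatibility of the definitions on ball and handle at the points of an end disc. -/
theorem side_of_b {i : Fin g} {c : Handle3} {d : Ball3} (h : D.b d = D.h i c) :
    D.side H c.2 i c = D.trB H Ball3.center d := by
  have hε : |(c.2 : ℝ)| = 1 := (h_mem_range_b (D := D) (i := i)).1 ⟨d, h⟩
  rw [side, ← trB_eq_trH (i := i) (c := axis c.2) (d := c) rfl (b_foot hε) h, trB_mul]

open Classical in
variable (D) (H) in
/-- The parallel section over the complement of the cores, extended over the cores from one of the
two sides. -/
def state (δ : Bool) (p : X) : Γ :=
  if h : ∃ d, D.b d = p then D.trB H Ball3.center h.choose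
  else if h : ∃ i c, D.h i c = p then
    if 0 < (h.choose_spec.choose.2 : ℝ) ∨ (h.choose_spec.choose.2 : ℝ) = 0 ∧ δ then
      D.side H top h.choose h.choose_spec.choose
    else D.side H bot h.choose h.choose_spec.choose
  else 1

theorem state_b (δ : Bool) (d : Ball3) : D.state H δ (D.b d) = D.trB H Ball3.center d := by
  have h : ∃ d', D.b d' = D.b d := ⟨d, rfl⟩
  rw [state, dif_pos h, D.isEmbedding_b.injective h.choose_spec]

open Classical in
theorem state_h (δ : Bool) (i : Fin g) (c : Handle3) : D.state H δ (D.h i c) =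
    if 0 < (c.2 : ℝ) ∨ (c.2 : ℝ) = 0 ∧ δ then D.side H top i c else D.side H bot i c := by
  by_cases hc : D.h i c ∈ range D.b
  · obtain ⟨d, hd⟩ := hc
    rw [← hd, state_b, ← side_of_b hd]
    rcases (abs_eq zero_le_one).1 ((h_mem_range_b (D := D) (i := i)).1 ⟨d, hd⟩) with h | h
    · rw [if_pos (Or.inl (by linarith))]
      congr 1
      exact Subtype.ext h
    · rw [if_neg (by rw [h]; norm_num)]
      congr 1
      exact Subtype.ext h
  · have h : ∃ k d, D.h k d = D.h i c := ⟨i, c, rfl⟩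
    rw [state, dif_neg (show ¬∃ d, D.b d = D.h i c from hc), dif_pos h]
    have e := h_inj h.choose_spec.choose_spec
    rw [e.2, e.1]

/-- The flag only breaks the tie at height 0. -/
theorem state_eq_of_notMem_core {p : X} (h : ∀ i, p ∉ D.core i) (δ δ' : Bool) :
    D.state H δ p = D.state H δ' p := by
  by_cases hb : ∃ d, D.b d = p
  · obtain ⟨d, rfl⟩ := hb
    rw [state_b, state_b]
  by_cases hh : ∃ i c, D.h i c = p
  · obtain ⟨i, c, rfl⟩ := hh
    have : (c.2 : ℝ) ≠ 0 := fun hc => h i (h_mem_core.2 ⟨rfl, hc⟩)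
    simp [state_h, this]
  · rw [state, state, dif_neg hb, dif_neg hb, dif_neg hh, dif_neg hh]

theorem locFlat_state_image (δ : Bool) (i : Fin g) {A : Set Handle3}
    (hA : (∀ c ∈ A, 0 < (c.2 : ℝ)) ∨ (∀ c ∈ A, (c.2 : ℝ) < 0) ∨ ∀ c ∈ A, (c.2 : ℝ) = 0) :
    H.LocFlat (D.state H δ) (D.h i '' A) := by
  classical
  refine Holonomy.LocFlat.image (D.isEmbedding_h i) fun c hc d hd => ?_
  change _ = D.trH H i c d * _
  rw [state_h, state_h]
  rcases hA with h | h | h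
  · rw [if_pos (Or.inl (h _ hc)), if_pos (Or.inl (h _ hd)), trH_mul_side]
  · have hc := h _ hc
    have hd := h _ hd
    rw [if_neg (by rintro (h | ⟨h, -⟩) <;> linarith),
      if_neg (by rintro (h | ⟨h, -⟩) <;> linarith), trH_mul_side]
  · rw [h _ hc, h _ hd]
    split_ifs <;> rw [trH_mul_side]

theorem locFlat_state_b (δ : Bool) : H.LocFlat (D.state H δ) (range D.b) := by
  rw [← image_univ]
  refine Holonomy.LocFlat.image D.isEmbedding_b fun c _ d _ => ?_
  rw [state_b, state_b]
  exact (trB_mul _ _ _).symm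

end Handlebody

end

/-! ### Words spelled by crossings of a path with the cores. -/

noncomputable section

open Topology unitInterval Set

universe v

namespace Handlebody

open Handle3

variable {g : ℕ} {X : Type*} [TopologicalSpace X] {D : Handlebody g X}
  {Γ : Type*} [Group Γ] {H : Holonomy X Γ}

theorem exists_of_mem_carrier {p : X} (hp : p ∈ D.carrier) :
    (∃ d, D.b d = p) ∨ ∃ i c, D.h i c = p := by
  rcases hp with ⟨d, hd⟩ | hp
  · exact .inl ⟨d, hd⟩
  · obtain ⟨i, c, hc⟩ := mem_iUnion.1 hp
    exact .inr ⟨i, c, hc⟩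

theorem isClosed_range_b [T2Space X] : IsClosed (range D.b) :=
  (isCompact_range D.isEmbedding_b.continuous).isClosed

theorem isClosed_range_h [T2Space X] (i : Fin g) : IsClosed (range (D.h i)) :=
  (isCompact_range (D.isEmbedding_h i).continuous).isClosed

theorem locFlat_state_compl_core [T2Space X] (δ : Bool) :
    H.LocFlat (D.state H δ) (D.carrier \ ⋃ i, D.core i) := by
  let P : Option (Fin g × Bool) → Set X := fun o => match o with
    | none => range D.b
    | some (i, true) => D.h i '' {c | 0 < (c.2 : ℝ)}
    | some (i, false) => D.h i '' {c | (c.2 : ℝ) < 0}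
  have hsub : D.carrier \ ⋃ i, D.core i ⊆ ⋃ o, P o := by
    rintro p ⟨hp, hc⟩
    rcases exists_of_mem_carrier hp with ⟨d, rfl⟩ | ⟨i, c, rfl⟩
    · exact mem_iUnion.2 ⟨none, d, rfl⟩
    · rcases lt_trichotomy (c.2 : ℝ) 0 with h | h | h
      · exact mem_iUnion.2 ⟨some (i, false), c, h, rfl⟩
      · exact (hc (mem_iUnion.2 ⟨i, h_mem_core.2 ⟨rfl, h⟩⟩)).elim
      · exact mem_iUnion.2 ⟨some (i, true), c, h, rfl⟩
  have hP : ∀ o, ∀ p ∈ P o, ∀ i, p ∉ D.core i := by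
    rintro (_ | ⟨k, _ | _⟩) p hp i
    · obtain ⟨d, rfl⟩ := hp
      exact b_notMem_core
    all_goals
      obtain ⟨c, hc, rfl⟩ := hp
      rw [h_mem_core]
      rintro ⟨-, h⟩
      simp [h] at hc
  have hcl : ∀ i (A B : Set Handle3), IsClosed B → A ⊆ B → closure (D.h i '' A) ⊆ D.h i '' B := by
    intro i A B hB hAB
    exact closure_minimal (image_mono hAB)
      (hB.isCompact.image (D.isEmbedding_h i).continuous).isClosed
  refine (Holonomy.LocFlat.iUnion (F := P) ?_ ?_).mono hsub
  · rintro (_ | ⟨k, _ | _⟩)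
    · exact locFlat_state_b δ
    · exact locFlat_state_image (A := {c | (c.2 : ℝ) < 0}) δ k (.inr (.inl fun _ => id))
    · exact locFlat_state_image (A := {c | 0 < (c.2 : ℝ)}) δ k (.inl fun _ => id)
  · rintro (_ | ⟨k, _ | _⟩) o p ⟨hp, hp'⟩
    · rwa [isClosed_range_b.closure_eq] at hp
    · obtain ⟨c, hc, rfl⟩ := hcl k {c | (c.2 : ℝ) < 0} {c | (c.2 : ℝ) ≤ 0}
        (isClosed_le (by fun_prop) continuous_const) (fun c hc => (mem_ofPred.1 hc).le) hp
      refine ⟨c, lt_of_le_of_ne hc fun h => hP o _ hp' k (h_mem_core.2 ⟨rfl, h⟩), rfl⟩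
    · obtain ⟨c, hc, rfl⟩ := hcl k {c | 0 < (c.2 : ℝ)} {c | 0 ≤ (c.2 : ℝ)}
        (isClosed_le continuous_const (by fun_prop)) (fun c hc => (mem_ofPred.1 hc).le) hp
      refine ⟨c, lt_of_le_of_ne hc fun h => hP o _ hp' k (h_mem_core.2 ⟨rfl, h.symm⟩), rfl⟩

theorem locFlat_state_core [T2Space X] (δ : Bool) :
    H.LocFlat (D.state H δ) (⋃ i, D.core i) :=
  Holonomy.LocFlat.iUnion (fun i => locFlat_state_image δ i (.inr (.inr fun c hc => hc)))
    fun i j => by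
      have := D.isClosed_core i
      rw [this.closure_eq]
      exact inter_subset_left

/-- The complement of the ball and of the other handles. -/
def handleNhd (D : Handlebody g X) (i : Fin g) : Set X :=
  (range D.b ∪ ⋃ k ∈ {k | k ≠ i}, range (D.h k))ᶜ

theorem isOpen_handleNhd [T2Space X] (i : Fin g) : IsOpen (D.handleNhd i) :=
  (isClosed_range_b.union ((Set.toFinite _).isClosed_biUnion fun k _ =>
    isClosed_range_h k)).isOpen_compl

theorem core_subset_handleNhd {i : Fin g} : D.core i ⊆ D.handleNhd i := by
  rintro _ ⟨c, hc, rfl⟩ (h | h)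
  · rw [h_mem_range_b, hc] at h
    simp at h
  · obtain ⟨k, hk, d, hd⟩ := mem_iUnion₂.1 h
    exact hk (h_inj hd).1

theorem exists_of_mem_handleNhd {i : Fin g} {p : X} (hp : p ∈ D.carrier) (h : p ∈ D.handleNhd i) :
    ∃ c, D.h i c = p := by
  rcases exists_of_mem_carrier hp with ⟨d, rfl⟩ | ⟨k, c, rfl⟩
  · exact (h (.inl ⟨d, rfl⟩)).elim
  · by_cases hk : k = i
    · exact ⟨c, by rw [hk]⟩
    · exact (h (.inr (mem_iUnion₂.2 ⟨k, hk, c, rfl⟩))).elim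

/-- The letters recording the crossings of a path with the cores: the handle, the sign and the
time. -/
abbrev Letter (g : ℕ) : Type := Fin g × ℤˣ × I

/-- The value of a word in the transports through the handles. -/
def wordVal (D : Handlebody g X) (H : Holonomy X Γ) (w : List (Letter g)) : Γ :=
  (w.map fun l => D.gen H l.1 ^ (l.2.1 : ℤ)).prod

open Classical in
/-- A short path through a handle contributes at most one letter. -/
theorem exists_letter {p q : X} (β : Path p q) (hβ : range β ⊆ D.carrier) {a b : I} (hab : a ≤ b)
    {i : Fin g} (hi : ∀ t ∈ Icc a b, β t ∈ D.handleNhd i) (δ : Bool) :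
    ∃ (δ' : Bool) (w : List (Letter g)), (w = [] ∨ ∃ ε τ, w = [(i, ε, τ)] ∧ a ≤ τ ∧ τ < b ∧
      β τ ∈ D.core i) ∧ ∀ (Γ : Type v) [Group Γ] (H : Holonomy X Γ),
        H.hol (β.subpath a b) * D.state H δ (β a) = D.state H δ' (β b) * D.wordVal H w := by
  have hc : ∀ t : Icc a b, ∃ c, D.h i c = β t := fun t =>
    exists_of_mem_handleNhd (hβ ⟨t, rfl⟩) (hi t t.2)
  choose c hc using hc
  have hcc : Continuous c := by
    rw [(D.isEmbedding_h i).continuous_iff]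
    exact (β.continuous.comp continuous_subtype_val).congr fun t => (hc t).symm
  let a' : Icc a b := ⟨a, left_mem_Icc.2 hab⟩
  let b' : Icc a b := ⟨b, right_mem_Icc.2 hab⟩
  have hhol : ∀ (Γ : Type v) [Group Γ] (H : Holonomy X Γ),
      H.hol (β.subpath a b) = D.trH H i (c a') (c b') := by
    intro Γ _ H
    refine H.hol_eq_tr_of_range_subset (D.isEmbedding_h i) _ (hc a').symm (hc b').symm ?_
    rw [Path.range_subpath, uIcc_of_le hab]
    rintro _ ⟨t, ht, rfl⟩
    exact ⟨c ⟨t, ht⟩, hc ⟨t, ht⟩⟩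
  have ha : β a = D.h i (c a') := (hc a').symm
  have hb : β b = D.h i (c b') := (hc b').symm
  have hcross : ∀ (h : ((c a').2 : ℝ) ≤ 0 ∧ 0 < ((c b').2 : ℝ) ∨
      0 ≤ ((c a').2 : ℝ) ∧ ((c b').2 : ℝ) < 0), ∃ τ, a ≤ τ ∧ τ < b ∧ β τ ∈ D.core i := by
    intro h
    have hcont : Continuous fun t : Icc a b => ((c t).2 : ℝ) := by fun_prop
    have : PreconnectedSpace (Icc a b) := Subtype.preconnectedSpace isPreconnected_Icc
    obtain ⟨τ, hτ⟩ : (0 : ℝ) ∈ range fun t : Icc a b => ((c t).2 : ℝ) := by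
      rcases h with ⟨h1, h2⟩ | ⟨h1, h2⟩
      · exact mem_range_of_exists_le_of_exists_ge hcont ⟨_, h1⟩ ⟨_, h2.le⟩
      · exact mem_range_of_exists_le_of_exists_ge hcont ⟨_, h2.le⟩ ⟨_, h1⟩
    -- The height at the end point is nonzero, so the crossing occurs strictly earlier. Times in
    -- half-open intervals keep the letters of consecutive pieces distinct.
    refine ⟨τ, τ.2.1, lt_of_le_of_ne τ.2.2 fun he => ?_, ?_⟩
    · obtain rfl : τ = b' := Subtype.ext he
      rcases h with ⟨h1, h2⟩ | ⟨h1, h2⟩ <;> simp only at hτ <;> linarith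
    · rw [← hc τ]
      exact h_mem_core.2 ⟨rfl, hτ⟩
  let sideA : Prop := 0 < ((c a').2 : ℝ) ∨ ((c a').2 : ℝ) = 0 ∧ δ
  have same : ∀ δ' : Bool, (sideA ↔ 0 < ((c b').2 : ℝ) ∨ ((c b').2 : ℝ) = 0 ∧ δ') →
      ∀ (Γ : Type v) [Group Γ] (H : Holonomy X Γ),
        H.hol (β.subpath a b) * D.state H δ (β a) = D.state H δ' (β b) * D.wordVal H [] := by
    intro δ' h Γ _ H
    rw [hhol, ha, hb, state_h, state_h]
    by_cases hA : sideA
    · rw [if_pos hA, if_pos (h.1 hA), trH_mul_side]; simp [wordVal]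
    · rw [if_neg hA, if_neg (fun h' => hA (h.2 h')), trH_mul_side]; simp [wordVal]
  -- If the piece ends on the core, the new flag records the side of departure and no letter is
  -- spent; the next piece decides whether a crossing takes place.
  by_cases hb0 : ((c b').2 : ℝ) = 0
  · refine ⟨decide sideA, [], .inl rfl, same _ ?_⟩
    simp [hb0]
  by_cases hs : sideA ↔ 0 < ((c b').2 : ℝ)
  · refine ⟨true, [], .inl rfl, same _ ?_⟩
    simp [hb0, hs]
  by_cases hA : sideA
  · have hbl : ((c b').2 : ℝ) < 0 :=
      lt_of_le_of_ne (not_lt.1 fun h => hs (iff_of_true hA h)) hb0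
    obtain ⟨τ, h1, h2, h3⟩ := hcross (.inr ⟨by rcases hA with h | h; exacts [h.le, h.1.ge], hbl⟩)
    refine ⟨true, _, .inr ⟨1, τ, rfl, h1, h2, h3⟩, fun Γ _ H => ?_⟩
    rw [hhol, ha, hb, state_h, state_h, if_pos hA, if_neg (by simp [hb0, hbl.le]), trH_mul_side,
      side_top]
    simp [wordVal]
  · have hbl : 0 < ((c b').2 : ℝ) := not_le.1 fun h => hs (iff_of_false hA (not_lt.2 h))
    obtain ⟨τ, h1, h2, h3⟩ := hcross (.inl ⟨not_lt.1 fun h => hA (.inl h), hbl⟩)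
    refine ⟨true, _, .inr ⟨-1, τ, rfl, h1, h2, h3⟩, fun Γ _ H => ?_⟩
    rw [hhol, ha, hb, state_h, state_h, if_neg hA, if_pos (.inl hbl), trH_mul_side,
      side_top]
    simp [wordVal]

theorem hol_mul_state_of_compl_core [T2Space X] {p q : X} (β : Path p q)
    (hβ : range β ⊆ D.carrier) {a b : I} (hab : a ≤ b)
    (hi : ∀ t ∈ Icc a b, ∀ i, β t ∉ D.core i) (δ : Bool) :
    H.hol (β.subpath a b) * D.state H δ (β a) = D.state H δ (β b) := by
  refine ((locFlat_state_compl_core δ).smul_eq (β.subpath a b) ?_).symm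
  rw [Path.range_subpath, uIcc_of_le hab]
  rintro _ ⟨t, ht, rfl⟩
  exact ⟨hβ ⟨t, rfl⟩, fun h => let ⟨i, h⟩ := mem_iUnion.1 h; hi t ht i h⟩

/-- The crossings of a path in a handlebody with the cores spell its holonomy. -/
theorem exists_word_path [T2Space X] {p q : X} (β : Path p q) (hβ : range β ⊆ D.carrier) :
    ∃ (δ : Bool) (w : List (Letter g)), (w.map fun l => l.2.2).Nodup ∧
      (∀ l ∈ w, l.2.2 < 1 ∧ β l.2.2 ∈ D.core l.1) ∧
      ∀ (Γ : Type v) [Group Γ] (H : Holonomy X Γ),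
        H.hol β * D.state H true p = D.state H δ q * D.wordVal H w := by
  let O : Option (Fin g) → Set I := fun o => match o with
    | none => β ⁻¹' (⋃ i, D.core i)ᶜ
    | some i => β ⁻¹' D.handleNhd i
  have hO : ∀ o, IsOpen (O o) := by
    rintro (_ | i)
    · exact (isClosed_iUnion_of_finite D.isClosed_core).isOpen_compl.preimage β.continuous
    · exact (isOpen_handleNhd i).preimage β.continuous
  have hcov : univ ⊆ ⋃ o, O o := by
    intro t _
    by_cases h : β t ∈ ⋃ i, D.core i
    · obtain ⟨i, hi⟩ := mem_iUnion.1 h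
      exact mem_iUnion.2 ⟨some i, core_subset_handleNhd hi⟩
    · exact mem_iUnion.2 ⟨none, h⟩
  -- After subdivision each piece avoids the cores or sees one handle only. The curve may meet the
  -- cores in any closed set of times, yet the word is finite.
  obtain ⟨t, h0, hmono, ⟨n, hn⟩, ht⟩ := exists_monotone_Icc_subset_open_cover_unitInterval hO hcov
  have key : ∀ k, ∃ (δ : Bool) (w : List (Letter g)), (w.map fun l => l.2.2).Nodup ∧
      (∀ l ∈ w, l.2.2 < t k ∧ β l.2.2 ∈ D.core l.1) ∧
      ∀ (Γ : Type v) [Group Γ] (H : Holonomy X Γ),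
        H.hol (β.subpath 0 (t k)) * D.state H true p = D.state H δ (β (t k)) * D.wordVal H w := by
    intro k
    induction k with
    | zero =>
      refine ⟨true, [], by simp, by simp, fun Γ _ H => ?_⟩
      have : H.hol (β.subpath 0 (t 0)) = 1 := by
        rw [h0, Path.subpath_self, H.hol_refl]
      rw [this, h0, β.source]; simp [wordVal]
    | succ k ih =>
      obtain ⟨δ, w, hnd, hw, hH⟩ := ih
      have hle := hmono (Nat.le_succ k)
      suffices ∃ (δ' : Bool) (w' : List (Letter g)), (w' = [] ∨ ∃ i ε τ, w' = [(i, ε, τ)] ∧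
          t k ≤ τ ∧ τ < t (k + 1) ∧ β τ ∈ D.core i) ∧
          ∀ (Γ : Type v) [Group Γ] (H : Holonomy X Γ),
            H.hol (β.subpath (t k) (t (k + 1))) * D.state H δ (β (t k)) =
              D.state H δ' (β (t (k + 1))) * D.wordVal H w' by
        obtain ⟨δ', w', hw', hH'⟩ := this
        have hval : ∀ (Γ : Type v) [Group Γ] (H : Holonomy X Γ),
            H.hol (β.subpath 0 (t (k + 1))) * D.state H true p =
              D.state H δ' (β (t (k + 1))) * D.wordVal H (w' ++ w) := by
          intro Γ _ H
          rw [H.hol_subpath_trans β 0 (t k), mul_assoc, hH, ← mul_assoc, hH', mul_assoc]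
          simp [wordVal]
        refine ⟨δ', w' ++ w, ?_, ?_, hval⟩
        · rcases hw' with rfl | ⟨i, ε, τ, rfl, h1, -⟩
          · exact hnd
          · rw [List.singleton_append, List.map_cons, List.nodup_cons]
            refine ⟨fun hmem => ?_, hnd⟩
            obtain ⟨l, hl, hlτ⟩ := List.mem_map.1 hmem
            exact absurd (hw l hl).1 (not_lt.2 (hlτ ▸ h1))
        · intro l hl
          rcases List.mem_append.1 hl with hl | hl
          · rcases hw' with rfl | ⟨i, ε, τ, rfl, -, h2, h3⟩
            · simp at hl
            · obtain rfl := List.mem_singleton.1 hl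
              exact ⟨h2, h3⟩
          · exact ⟨(hw l hl).1.trans_le hle, (hw l hl).2⟩
      obtain ⟨_ | i, hi⟩ := ht k
      · refine ⟨δ, [], .inl rfl, fun Γ _ H => ?_⟩
        rw [hol_mul_state_of_compl_core β hβ hle
          fun s hs i hsi => hi hs (mem_iUnion.2 ⟨i, hsi⟩)]
        simp [wordVal]
      · obtain ⟨δ', w', hw', hH'⟩ := exists_letter β hβ hle (fun s hs => hi hs) δ
        refine ⟨δ', w', hw'.imp id ?_, hH'⟩
        rintro ⟨ε, τ, h⟩
        exact ⟨i, ε, τ, h⟩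
  obtain ⟨δ, w, hnd, hw, hH⟩ := key n
  rw [hn n le_rfl] at hw
  refine ⟨δ, w, hnd, hw, fun Γ _ H => ?_⟩
  have h := hH Γ H
  have h1 : H.hol (β.subpath 0 (t n)) = H.hol β := by
    rw [hn n le_rfl, H.hol_subpath_zero_one]
  rwa [h1, hn n le_rfl, β.target] at h

/-- The crossings of a loop in a handlebody with the cores spell its holonomy up to conjugation. -/
theorem exists_word_loop [T2Space X] {p : X} (β : Path p p) (hβ : range β ⊆ D.carrier)
    (hp : (∀ i, p ∉ D.core i) ∨ ∀ t, β t ∈ ⋃ i, D.core i) :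
    ∃ w : List (Letter g), (w.map fun l => l.2.2).Nodup ∧
      (∀ l ∈ w, l.2.2 < 1 ∧ β l.2.2 ∈ D.core l.1) ∧
      ∀ (Γ : Type v) [Group Γ] (H : Holonomy X Γ), ∃ c,
        H.hol β = c * D.wordVal H w * c⁻¹ := by
  -- Off the cores the initial and final states agree, whatever the flags, and this state is the
  -- conjugating element. A loop inside the cores has trivial transport and gets the empty word.
  rcases hp with hp | hp
  · obtain ⟨δ, w, hnd, hw, hH⟩ := exists_word_path β hβ
    refine ⟨w, hnd, hw, fun Γ _ H => ⟨D.state H true p, ?_⟩⟩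
    rw [state_eq_of_notMem_core hp true δ, ← hH, state_eq_of_notMem_core hp true δ,
      mul_inv_cancel_right]
  · refine ⟨[], by simp, by simp, fun Γ _ H => ⟨1, ?_⟩⟩
    have := (locFlat_state_core (H := H) (D := D) true).smul_eq β (by rintro _ ⟨t, rfl⟩; exact hp t)
    simpa [wordVal] using this
end Handlebody

end

/-! ### Closed curves, boundaries of handlebodies and Heegaard splittings. -/

noncomputable section

open Topology unitInterval Set

universe v

/-- The loop running once along a closed curve. -/
def circlePath {X : Type*} [TopologicalSpace X] (κ : C(Circle, X)) (z : Circle) :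
    Path (κ z) (κ z) where
  toFun t := κ (z * Circle.exp (2 * Real.pi * t))
  source' := by simp
  target' := by simp

theorem circlePath_apply {X : Type*} [TopologicalSpace X] (κ : C(Circle, X)) (z : Circle) (t : I) :
    circlePath κ z t = κ (z * Circle.exp (2 * Real.pi * t)) := rfl

theorem circle_param_injOn {z : Circle} {s t : I} (hs : s < 1) (ht : t < 1)
    (h : z * Circle.exp (2 * Real.pi * s) = z * Circle.exp (2 * Real.pi * t)) : s = t := by
  have h := mul_left_cancel h
  obtain ⟨m, hm⟩ := Circle.exp_eq_exp.1 h
  have hpi := Real.pi_pos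
  have h1 : (s : ℝ) = t + m := by
    have : 2 * Real.pi * s = 2 * Real.pi * (t + m) := by linarith
    exact mul_left_cancel₀ (by positivity) this
  have hs0 := s.2.1
  have ht0 := t.2.1
  have hs' : (s : ℝ) < 1 := hs
  have ht' : (t : ℝ) < 1 := ht
  have hm1 : m < 1 := by
    have : (m : ℝ) < 1 := by linarith
    exact_mod_cast this
  have hm2 : -1 < m := by
    have : (-1 : ℝ) < m := by linarith
    exact_mod_cast this
  obtain rfl : m = 0 := by omega
  exact Subtype.ext (by simpa using h1)

namespace Handlebody

open Handle3

variable {g : ℕ} {X : Type*} [TopologicalSpace X] {D : Handlebody g X}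
  {Γ : Type*} [Group Γ] {H : Holonomy X Γ}

/-- The value of a word in the transports through the handles. -/
def eval (D : Handlebody g X) (H : Holonomy X Γ) (w : List (Fin g × ℤˣ × Circle)) : Γ :=
  (w.map fun l => D.gen H l.1 ^ (l.2.1 : ℤ)).prod

/-- The intersections of a closed curve with the cores of a handlebody spell its holonomy. -/
theorem exists_word_curve [T2Space X] (κ : C(Circle, X)) (hκ : ∀ z, κ z ∈ D.carrier) :
    ∃ (z : Circle) (w : List (Fin g × ℤˣ × Circle)), (w.map fun l => l.2.2).Nodup ∧
      (∀ l ∈ w, κ l.2.2 ∈ D.core l.1) ∧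
      ∀ (Γ : Type v) [Group Γ] (H : Holonomy X Γ), ∃ c,
        H.hol (circlePath κ z) = c * D.eval H w * c⁻¹ := by
  obtain ⟨z, hz⟩ : ∃ z, (∀ i, κ z ∉ D.core i) ∨ ∀ z, κ z ∈ ⋃ i, D.core i := by
    by_cases h : ∃ z, ∀ i, κ z ∉ D.core i
    · obtain ⟨z, h⟩ := h
      exact ⟨z, .inl h⟩
    · push Not at h
      exact ⟨1, .inr fun z => mem_iUnion.2 (h z)⟩
  obtain ⟨w, hnd, hw, hH⟩ := exists_word_loop (D := D) (circlePath κ z)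
    (by rintro _ ⟨t, rfl⟩; exact hκ _) (hz.imp id fun h t => h _)
  refine ⟨z, w.map fun l => (l.1, l.2.1, z * Circle.exp (2 * Real.pi * l.2.2)), ?_, ?_, ?_⟩
  · rw [List.map_map]
    refine List.Nodup.map_on (fun l hl l' hl' he => ?_) hnd.of_map
    -- All times are strictly less than 1, so distinct times are distinct points of the circle.
    exact List.inj_on_of_nodup_map hnd hl hl' (circle_param_injOn (hw l hl).1 (hw l' hl').1 he)
  · intro l hl
    obtain ⟨l', hl', rfl⟩ := List.mem_map.1 hl
    exact (hw l' hl').2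
  · intro Γ _ H
    obtain ⟨c, hc⟩ := hH Γ H
    refine ⟨c, hc.trans ?_⟩
    rw [eval, List.map_map]; rfl

theorem b_mem_carrier (d : Ball3) : D.b d ∈ D.carrier := .inl ⟨d, rfl⟩

theorem h_mem_carrier (i : Fin g) (c : Handle3) : D.h i c ∈ D.carrier :=
  .inr (mem_iUnion.2 ⟨i, ⟨c, rfl⟩⟩)

/-- A handlebody as a space of its own. -/
def restrict (D : Handlebody g X) : Handlebody g D.carrier where
  b := codRestrict D.b _ b_mem_carrier
  h i := codRestrict (D.h i) _ (h_mem_carrier i)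
  isEmbedding_b := D.isEmbedding_b.codRestrict _ _
  isEmbedding_h i := (D.isEmbedding_h i).codRestrict _ _
  disjoint i k hik := by
    refine disjoint_left.2 ?_
    rintro _ ⟨c, rfl⟩ ⟨d, hd⟩
    exact hik (h_inj (congrArg Subtype.val hd)).1.symm
  inter i := by
    ext p
    constructor
    · rintro ⟨⟨c, rfl⟩, d, hd⟩
      exact ⟨c, h_mem_range_b.1 ⟨d, congrArg Subtype.val hd⟩, rfl⟩
    · rintro ⟨c, hc, rfl⟩
      obtain ⟨d, hd⟩ := (h_mem_range_b (D := D) (i := i) (c := c)).2 hc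
      exact ⟨⟨c, rfl⟩, d, Subtype.ext hd⟩
  ends_subset i := by
    rintro _ ⟨c, hc, rfl⟩
    obtain ⟨d, hd, he⟩ := D.ends_subset i ⟨c, hc, rfl⟩
    exact ⟨d, hd, Subtype.ext he⟩

theorem restrict_carrier : D.restrict.carrier = univ := by
  refine eq_univ_of_forall fun p => ?_
  obtain ⟨p, hp⟩ := p
  rcases exists_of_mem_carrier hp with ⟨d, rfl⟩ | ⟨i, c, rfl⟩
  · exact b_mem_carrier (D := D.restrict) d
  · exact h_mem_carrier (D := D.restrict) i c

/-- At the ends of the axis injectivity of `b` determines the foot; at other heights it is a default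
value. -/
theorem restrict_foot {i : Fin g} {ε : Icc (-1 : ℝ) 1} (hε : |(ε : ℝ)| = 1) :
    D.restrict.foot i ε = D.foot i ε := by
  apply D.isEmbedding_b.injective
  rw [b_foot hε]
  exact congrArg Subtype.val (b_foot (D := D.restrict) (i := i) hε)

theorem restrict_gen (i : Fin g) :
    D.restrict.gen (H.pullback (continuous_subtype_val (p := (· ∈ D.carrier)))) i = D.gen H i := by
  have h : ∀ ε : Icc (-1 : ℝ) 1, |(ε : ℝ)| = 1 → ∀ c,
      D.restrict.side (H.pullback (continuous_subtype_val (p := (· ∈ D.carrier)))) ε i c =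
        D.side H ε i c := by
    intro ε hε c
    rw [side, side, restrict_foot hε]
    rfl
  rw [gen, gen, h bot (by rw [bot]; norm_num), h top (by rw [top]; norm_num)]

theorem restrict_eval (w : List (Fin g × ℤˣ × Circle)) :
    D.restrict.eval (H.pullback (continuous_subtype_val (p := (· ∈ D.carrier)))) w =
      D.eval H w := by
  simp_rw [eval, restrict_gen]

/-- The boundary surface of a handlebody. -/
def boundary (D : Handlebody g X) : Set X :=
  (D.b '' {x | ‖(x : EuclideanSpace ℝ (Fin 3))‖ = 1} \
      ⋃ i, D.h i '' {p | ‖(p.1 : ℂ)‖ < 1 ∧ |(p.2 : ℝ)| = 1}) ∪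
    ⋃ i, D.h i '' {p | ‖(p.1 : ℂ)‖ = 1}

theorem b_eq_h {d : Ball3} {i : Fin g} {c : Handle3} (h : D.b d = D.h i c) :
    ‖(d : EuclideanSpace ℝ (Fin 3))‖ = 1 ∧ |(c.2 : ℝ)| = 1 := by
  have hc : |(c.2 : ℝ)| = 1 := (h_mem_range_b (D := D) (i := i)).1 ⟨d, h⟩
  obtain ⟨d', hd', he⟩ := D.ends_subset i ⟨c, hc, rfl⟩
  rw [D.isEmbedding_b.injective (h.trans he.symm)]
  exact ⟨hd', hc⟩

/-- The open end discs have been removed from the sphere, so a boundary point in a handle lies on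
its side annulus. -/
theorem norm_of_h_mem_boundary {i : Fin g} {c : Handle3} (h : D.h i c ∈ D.boundary) :
    ‖(c.1 : ℂ)‖ = 1 := by
  rcases h with ⟨⟨d, hd, he⟩, hn⟩ | h
  · by_contra hc
    exact hn (mem_iUnion.2 ⟨i, c, ⟨lt_of_le_of_ne (mem_closedBall_zero_iff.1 c.1.2) hc, (b_eq_h he).2⟩, rfl⟩)
  · obtain ⟨k, c', hc', he⟩ := mem_iUnion.1 h
    obtain ⟨rfl, rfl⟩ := h_inj he
    exact hc'

theorem h_mem_boundary {i : Fin g} {c : Handle3} (h : ‖(c.1 : ℂ)‖ = 1) : D.h i c ∈ D.boundary :=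
  .inr (mem_iUnion.2 ⟨i, c, h, rfl⟩)

theorem norm_of_b_mem_boundary {d : Ball3} (h : D.b d ∈ D.boundary) :
    ‖(d : EuclideanSpace ℝ (Fin 3))‖ = 1 := by
  rcases h with ⟨⟨d', hd, he⟩, -⟩ | h
  · rwa [← D.isEmbedding_b.injective he]
  · obtain ⟨k, c', -, he⟩ := mem_iUnion.1 h
    exact (b_eq_h he.symm).1

theorem b_mem_of_norm {d : Ball3} (h : ‖(d : EuclideanSpace ℝ (Fin 3))‖ = 1) :
    D.b d ∈ D.boundary ∪ ⋃ i, range (D.h i) := by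
  by_cases hd : D.b d ∈ ⋃ i, D.h i '' {p | ‖(p.1 : ℂ)‖ < 1 ∧ |(p.2 : ℝ)| = 1}
  · obtain ⟨i, c, -, hc⟩ := mem_iUnion.1 hd
    exact .inr (mem_iUnion.2 ⟨i, c, hc⟩)
  · exact .inl (.inl ⟨⟨d, h, rfl⟩, hd⟩)

/-- This turns a crossing of a β curve with a core into an intersection point of β with α. -/
theorem core_inter_boundary {i : Fin g} {p : X} (hp : p ∈ D.core i) (h : p ∈ D.boundary) :
    ∃ z : Circle, p = D.h i (belt z) := by
  obtain ⟨c, hc, rfl⟩ := hp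
  refine ⟨⟨c.1, by simpa [Submonoid.unitSphere] using norm_of_h_mem_boundary h⟩, ?_⟩
  congr 1
  exact Prod.ext rfl (Subtype.ext hc)

end Handlebody

/-- Two handlebodies which cover a space and meet exactly along their common boundary. -/
structure HeegaardSplitting (g : ℕ) (Y : Type*) [TopologicalSpace Y] where
  D : Handlebody g Y
  D' : Handlebody g Y
  union : D.carrier ∪ D'.carrier = univ
  inter : D.carrier ∩ D'.carrier = D.boundary
  boundary : D.boundary = D'.boundary

theorem Handle3.continuous_belt : Continuous Handle3.belt := by
  unfold Handle3.belt
  fun_prop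

theorem Handle3.norm_belt (z : Circle) : ‖((Handle3.belt z).1 : ℂ)‖ = 1 := Circle.norm_coe z

theorem Handle3.belt_injective : Function.Injective Handle3.belt := fun _ _ h =>
  Circle.ext (congrArg (fun c : Handle3 => (c.1 : ℂ)) h)

/-- The side annulus of the standard handle. -/
def Handle3.annulus (a : Circle × Icc (-1 : ℝ) 1) : Handle3 := ((Handle3.belt a.1).1, a.2)

theorem Handle3.isClosedEmbedding_annulus : IsClosedEmbedding Handle3.annulus := by
  refine Continuous.isClosedEmbedding ?_ ?_
  · exact (continuous_fst.comp (Handle3.continuous_belt.comp continuous_fst)).prodMk continuous_snd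
  · rintro ⟨z, t⟩ ⟨z', t'⟩ h
    exact Prod.ext (Circle.ext (congrArg (fun c : Handle3 => (c.1 : ℂ)) h)) (congrArg (fun c : Handle3 => c.2) h)

theorem Handle3.exists_annulus_eq {c : Handle3} (hc : ‖(c.1 : ℂ)‖ = 1) :
    ∃ a, Handle3.annulus a = c :=
  ⟨(⟨c.1, by simpa [Submonoid.unitSphere] using hc⟩, c.2), rfl⟩

namespace HeegaardSplitting

open Handlebody Handle3

variable {g : ℕ} {Y : Type*} [TopologicalSpace Y] (T : HeegaardSplitting g Y)

variable {T} in
theorem mem_of_boundary {p : Y} (h : p ∈ T.D'.boundary) : p ∈ T.D.carrier := by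
  rw [← T.boundary, ← T.inter] at h
  exact h.1

variable {T} in
theorem boundary_of_mem {p : Y} (h : p ∈ T.D.carrier) (h' : p ∈ T.D'.carrier) :
    p ∈ T.D'.boundary := by
  rw [← T.boundary, ← T.inter]
  exact ⟨h, h'⟩

-- Seen from the first handlebody, the handles of the second are 2-handles attached along their side
-- annuli.
variable {T} in
theorem mem_iff_h' {i : Fin g} {c : Handle3} : T.D'.h i c ∈ T.D.carrier ↔ ‖(c.1 : ℂ)‖ = 1 :=
  ⟨fun h => norm_of_h_mem_boundary
    (boundary_of_mem h (h_mem_carrier i c)), fun h => mem_of_boundary (h_mem_boundary h)⟩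

-- The ball of the second handlebody is a 3-handle attached along its whole boundary sphere.
variable {T} in
theorem b'_mem_iff {d : Ball3} : T.D'.b d ∈ T.D.carrier ∪ ⋃ i, range (T.D'.h i) ↔
      ‖(d : EuclideanSpace ℝ (Fin 3))‖ = 1 := by
  constructor
  · rintro (h | h)
    · exact norm_of_b_mem_boundary (boundary_of_mem h (.inl ⟨d, rfl⟩))
    · obtain ⟨i, c, hc⟩ := mem_iUnion.1 h
      exact (b_eq_h hc.symm).1
  · intro h
    exact (b_mem_of_norm h).imp mem_of_boundary id

/-- The attaching curve of a handle of the second handlebody in the first. -/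
def curve (j : Fin g) : C(Circle, T.D.carrier) where
  toFun z := ⟨T.D'.h j (belt z), mem_iff_h'.2 (norm_belt z)⟩
  continuous_toFun :=
    ((T.D'.isEmbedding_h j).continuous.comp continuous_belt).subtype_mk _

/-- The curve lies in a simply connected handle of the second handlebody. This is where the relators
come from. -/
theorem hol_curve {Γ : Type*} [Group Γ] (H : Holonomy Y Γ) (j : Fin g) (z : Circle) :
    (H.pullback (continuous_subtype_val (p := (· ∈ T.D.carrier)))).hol
      (circlePath (T.curve j) z) = 1 := by
  refine (H.hol_eq_tr_of_range_subset (T.D'.isEmbedding_h j) (c := belt z) (d := belt z)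
    ((circlePath (T.curve j) z).map continuous_subtype_val) rfl rfl ?_).trans (Holonomy.tr_self _ _)
  rintro _ ⟨t, rfl⟩
  exact ⟨_, rfl⟩

end HeegaardSplitting

/-! ### The handle loops generate the holonomy group. -/

namespace HeegaardSplitting

open Handlebody Handle3 Holonomy

variable {g : ℕ} {Y : Type*} [TopologicalSpace Y] (T : HeegaardSplitting g Y)
  {Γ : Type*} [Group Γ] {H : Holonomy Y Γ}

/-- Path connectedness of an attaching region gives the compatibility required by
`LocFlat.exists_extend`. -/
theorem _root_.Holonomy.LocFlat.tr_smul {M : Type*} [MulAction Γ M] {s : Y → M} {F : Set Y}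
    (hs : H.LocFlat s F) {A C : Type*} [TopologicalSpace A] [PathConnectedSpace A]
    [TopologicalSpace C] [SimplyConnectedSpace C] {j : C → Y} (hj : IsEmbedding j) {φ : A → C}
    (hφ : Continuous φ) (h : ∀ a, j (φ a) ∈ F) (a a' : A) :
    s (j (φ a')) = (H.pullback hj.continuous).tr (φ a) (φ a') • s (j (φ a)) := by
  rw [← hol_eq_tr _ ((PathConnectedSpace.somePath a a').map hφ), pullback_hol]
  refine hs.smul_eq _ ?_
  rintro _ ⟨t, rfl⟩
  exact h _

variable [T2Space Y]

theorem isClosed_carrier {D : Handlebody g Y} : IsClosed D.carrier :=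
  isClosed_range_b.union (isClosed_iUnion_of_finite isClosed_range_h)

/-- A subgroup containing the transports through the handles of the first handlebody is the
isotropy group of a parallel section. -/
theorem exists_locFlat (K : Subgroup Γ) (hK : ∀ i, T.D.gen H i ∈ K) :
    ∃ s : Y → Γ ⧸ K, H.LocFlat s univ ∧ s (T.D.b Ball3.center) = (1 : Γ) := by
  -- The jumps of `state` at the cores are generators, which disappear modulo `K`.
  let s₀ : Y → Γ ⧸ K := fun p => QuotientGroup.mk (T.D.state H true p)
  have hs₀b : ∀ d, s₀ (T.D.b d) = QuotientGroup.mk (T.D.trB H Ball3.center d) := fun d =>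
    congrArg _ (state_b _ _)
  have hs₀h : ∀ i c, s₀ (T.D.h i c) = QuotientGroup.mk (T.D.side H bot i c) := by
    classical
    intro i c
    change QuotientGroup.mk (T.D.state H true (T.D.h i c)) = _
    rw [state_h]
    split_ifs
    · rw [side_top]
      exact (QuotientGroup.eq.2 (by simpa using hK i)).symm
    · rfl
  have h1 : H.LocFlat s₀ T.D.carrier := by
    refine LocFlat.union ?_ (LocFlat.iUnion (F := fun i => range (T.D.h i)) (fun i => ?_) ?_) ?_ ?_
    · rw [← image_univ]
      refine LocFlat.image T.D.isEmbedding_b fun c _ d _ => ?_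
      rw [hs₀b, hs₀b]
      exact congrArg _ (trB_mul _ _ _).symm
    · rw [← image_univ]
      refine LocFlat.image (T.D.isEmbedding_h i) fun c _ d _ => ?_
      rw [hs₀h, hs₀h]
      exact congrArg _ (trH_mul_side _ _ _ _).symm
    · intro i k
      rw [(isClosed_range_h i).closure_eq]; exact inter_subset_left
    · rw [isClosed_range_b.closure_eq]; exact inter_subset_left
    · rw [(isClosed_iUnion_of_finite isClosed_range_h).closure_eq]; exact inter_subset_left
  obtain ⟨s₁, he₁, h2⟩ := h1.exists_extend T.D'.isEmbedding_h T.D'.disjoint isClosed_carrier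
    (fun i => ⟨belt 1, mem_iff_h'.2 (norm_belt 1)⟩) (by
      intro i c d hc hd
      have : PathConnectedSpace (Icc (-1 : ℝ) 1) := isPathConnected_iff_pathConnectedSpace.1
        ((convex_Icc _ _).isPathConnected ⟨0, by simp⟩)
      have : PathConnectedSpace Circle := Circle.exp_surjective.pathConnectedSpace
          Circle.exp.continuous
      obtain ⟨a, rfl⟩ := exists_annulus_eq (mem_iff_h'.1 hc)
      obtain ⟨a', rfl⟩ := exists_annulus_eq (mem_iff_h'.1 hd)
      exact h1.tr_smul (T.D'.isEmbedding_h i) isClosedEmbedding_annulus.continuous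
        (fun a => mem_iff_h'.2 (norm_belt a.1)) a a')
  have hsph : PathConnectedSpace (Metric.sphere (0 : EuclideanSpace ℝ (Fin 3)) 1) :=
    isPathConnected_iff_pathConnectedSpace.1 (isPathConnected_sphere
      (by rw [← Module.finrank_eq_rank]; simp) 0 zero_le_one)
  have hFc : IsClosed (T.D.carrier ∪ ⋃ i, range (T.D'.h i)) :=
    isClosed_carrier.union (isClosed_iUnion_of_finite isClosed_range_h)
  let φ : Metric.sphere (0 : EuclideanSpace ℝ (Fin 3)) 1 → Ball3 :=
    inclusion Metric.sphere_subset_closedBall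
  obtain ⟨s₂, he₂, h3⟩ := h2.exists_extend (ι := Unit) (j := fun _ => T.D'.b)
    (fun _ => T.D'.isEmbedding_b) (fun a b h => (h (Subsingleton.elim a b)).elim) hFc
    (fun _ => by
      obtain ⟨a⟩ := hsph.nonempty
      exact ⟨φ a, b'_mem_iff.2 (mem_sphere_zero_iff_norm.1 a.2)⟩) (by
      intro _ c d hc hd
      exact h2.tr_smul T.D'.isEmbedding_b (φ := φ) (continuous_inclusion _)
        (fun a => b'_mem_iff.2 (mem_sphere_zero_iff_norm.1 a.2))
        ⟨c, mem_sphere_zero_iff_norm.2 (b'_mem_iff.1 hc)⟩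
        ⟨d, mem_sphere_zero_iff_norm.2 (b'_mem_iff.1 hd)⟩)
  refine ⟨s₂, h3.mono fun p _ => ?_, ?_⟩
  · have hp : p ∈ T.D.carrier ∪ T.D'.carrier := T.union ▸ mem_univ p
    rcases hp with hp | hp | hp
    · exact .inl (.inl hp)
    · exact .inr (mem_iUnion.2 ⟨(), hp⟩)
    · exact .inl (.inr hp)
  · rw [← he₂ (.inl (.inl ⟨_, rfl⟩)), ← he₁ (.inl ⟨_, rfl⟩), hs₀b]
    congr 1
    exact Holonomy.tr_self _ _

/-- The transports through the handles of the first handlebody generate the holonomy group. -/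
theorem closure_gen_eq_top {y : Y} (hH : ∀ g : Γ, ∃ γ : Path y y, H.hol γ = g) :
    Subgroup.closure (range (T.D.gen H)) = ⊤ := by
  obtain ⟨s, hs, -⟩ := T.exists_locFlat (H := H) (Subgroup.closure (range (T.D.gen H)))
    fun i => Subgroup.subset_closure ⟨i, rfl⟩
  obtain ⟨c, hc⟩ := QuotientGroup.mk_surjective (s y)
  refine eq_top_iff.2 fun g _ => ?_
  -- The section has the value `c K` at `y`, with stabilizer `c K c⁻¹`, hence the conjugation.
  obtain ⟨γ, hγ⟩ := hH (c * g * c⁻¹)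
  have h := hs.smul_eq γ (subset_univ _)
  rw [hγ, ← hc] at h
  have := QuotientGroup.eq.1 (h : QuotientGroup.mk c = QuotientGroup.mk (c * g * c⁻¹ * c))
  simpa using this

end HeegaardSplitting

end

/-! ### Determinants of letter matrices and left orders. -/

noncomputable section

open Set

/-- A group generated by `x i` subject at least to the relations given by the rows of a nonsingular
square integer matrix has at most `|det M|` elements. -/
theorem AddCommGroup.natCard_le_natAbs_det {n A : Type*} [Fintype n] [DecidableEq n]
    [AddCommGroup A] (M : Matrix n n ℤ) (hM : M.det ≠ 0) (x : n → A)
    (hx : AddSubgroup.closure (range x) = ⊤) (hr : ∀ j, ∑ i, M j i • x i = 0) :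
    Nat.card A ≤ M.det.natAbs := by
  let f : (n → ℤ) →ₗ[ℤ] (n → ℤ) := Matrix.vecMulLinear M
  have hf : Function.Injective f := by
    rw [← LinearMap.ker_eq_bot, LinearMap.ker_eq_bot']
    intro v hv
    by_contra hv0
    exact hM (Matrix.exists_vecMul_eq_zero_iff.1 ⟨v, hv0, hv⟩)
  let e := LinearEquiv.ofInjective f hf
  -- The modulus of the determinant is the order of the cokernel, of which `A` is a quotient.
  have hcard : M.det.natAbs = Nat.card ((n → ℤ) ⧸ LinearMap.range f) := by
    rw [← Submodule.natAbs_det_equiv (LinearMap.range f) e]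
    congr 1
    rw [← Matrix.det_transpose, ← LinearMap.det_toLin']
    congr 1
    refine LinearMap.ext fun v => ?_
    rw [Matrix.toLin'_apply, Matrix.mulVec_transpose]
    rfl
  have hfin : Finite ((n → ℤ) ⧸ LinearMap.range f) :=
    Nat.finite_of_card_ne_zero (by rw [← hcard]; exact Int.natAbs_ne_zero.2 hM)
  let φ : (n → ℤ) →ₗ[ℤ] A := Fintype.linearCombination ℤ x
  have hφ : Function.Surjective φ := by
    have : φ.toAddMonoidHom.range = ⊤ := by
      rw [eq_top_iff, ← hx, AddSubgroup.closure_le]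
      rintro _ ⟨i, rfl⟩
      exact ⟨Pi.single i 1, by simp [φ, Fintype.linearCombination_apply_single]⟩
    exact AddMonoidHom.range_eq_top.1 this
  have hk : LinearMap.range f ≤ LinearMap.ker φ := by
    rintro _ ⟨v, rfl⟩
    simp only [LinearMap.mem_ker, φ, f, Fintype.linearCombination_apply, Matrix.vecMulLinear_apply,
      Matrix.vecMul, dotProduct, Finset.sum_smul, mul_smul]
    rw [Finset.sum_comm]
    simp [← Finset.smul_sum, hr]
  rw [hcard]
  refine Nat.card_le_card_of_surjective ((LinearMap.range f).liftQ φ hk) fun a => ?_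
  obtain ⟨v, rfl⟩ := hφ a
  exact ⟨Submodule.Quotient.mk v, rfl⟩

namespace LetterMatrix

variable {n : Type*} [Fintype n] [DecidableEq n] {L : n → Type*}
  (row : ∀ j, L j → n) (ε : ∀ j, L j → ℤˣ)

/-- The contribution of a choice of letters to the determinant. -/
def term (κ : ∀ j, L j) : ℤ :=
  Matrix.det fun j => (ε j (κ j) : ℤ) • Pi.single (M := fun _ => ℤ) (row j (κ j)) 1

theorem term_eq (κ : ∀ j, L j) : term row ε κ = (∏ j, (ε j (κ j) : ℤ)) *
    Matrix.det fun j => Pi.single (M := fun _ => ℤ) (row j (κ j)) 1 :=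
  (Matrix.detRowAlternating (n := n) (R := ℤ)).toMultilinearMap.map_smul_univ _ _

theorem term_eq_zero {κ : ∀ j, L j} (h : ¬ Function.Injective fun j => row j (κ j)) :
    term row ε κ = 0 := by
  rw [term_eq]
  simp only [Function.Injective, not_forall] at h
  obtain ⟨i, j, h, hij⟩ := h
  exact mul_eq_zero_of_right _ (Matrix.det_zero_of_row_eq hij (congrArg (Pi.single · 1) h))

theorem term_eq_unit {κ : ∀ j, L j} (h : Function.Injective fun j => row j (κ j)) :
    ∃ u : ℤˣ, term row ε κ = u := by
  let σ : Equiv.Perm n := Equiv.ofBijective _ (Finite.injective_iff_bijective.1 h)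
  have h1 : (fun j => Pi.single (M := fun _ => ℤ) (row j (κ j)) 1 : Matrix n n ℤ) =
      (1 : Matrix n n ℤ).submatrix σ id := by
    ext i j
    simp [Matrix.one_apply, Pi.single_apply, σ, eq_comm]
  refine ⟨(∏ j, ε j (κ j)) * Equiv.Perm.sign σ, ?_⟩
  rw [term_eq, h1, Matrix.det_permute, Matrix.det_one]
  simp

variable [∀ j, Fintype (L j)]

/-- The matrix of weighted exponent sums. -/
def mat {R : Type*} [CommRing R] (c : ∀ j, L j → R) : Matrix n n R :=
  fun j => ∑ l, c j l • fun i => (((ε j l : ℤ) • Pi.single (M := fun _ => ℤ) (row j l) 1 : n → ℤ) i : R)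

theorem det_mat {R : Type*} [CommRing R] (c : ∀ j, L j → R) :
    (mat row ε c).det = ∑ κ : ∀ j, L j, (∏ j, c j (κ j)) * (term row ε κ : R) := by
  have h := (Matrix.detRowAlternating (n := n) (R := R)).toMultilinearMap.map_sum fun j l =>
    c j l • fun i => (((ε j l : ℤ) • Pi.single (M := fun _ => ℤ) (row j l) 1 : n → ℤ) i : R)
  refine h.trans (Finset.sum_congr rfl fun κ _ => ?_)
  rw [MultilinearMap.map_smul_univ, smul_eq_mul]
  congr 1
  exact ((Int.castRingHom R).map_det _).symm

/-- If the determinant has as large a modulus as the number of its terms allows, then all terms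
have the same sign, and the determinant does not vanish for any positive weights. -/
theorem det_mat_ne_zero (h0 : (mat row ε fun _ _ => (1 : ℤ)).det ≠ 0)
    (h : Nat.card {κ : ∀ j, L j // Function.Injective fun j => row j (κ j)} ≤
      (mat row ε fun _ _ => (1 : ℤ)).det.natAbs) {c : ∀ j, L j → ℝ} (hc : ∀ j l, 0 < c j l) :
    (mat row ε c).det ≠ 0 := by
  classical
  let Gen := Finset.univ.filter fun κ : ∀ j, L j => Function.Injective fun j => row j (κ j)
  have hcard : Gen.card = Nat.card {κ : ∀ j, L j // Function.Injective fun j => row j (κ j)} := by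
    rw [Nat.card_eq_fintype_card, Fintype.card_subtype]
  have hsum : ∀ {R : Type} [CommRing R] (c : ∀ j, L j → R),
      (mat row ε c).det = ∑ κ ∈ Gen, (∏ j, c j (κ j)) * (term row ε κ : R) := by
    intro R _ c
    rw [det_mat, Finset.sum_filter_of_ne]
    intro κ _ hne
    by_contra hinj
    simp [term_eq_zero row ε hinj] at hne
  have hdet := hsum fun _ _ => (1 : ℤ)
  simp only [Finset.prod_const_one, one_mul, Int.cast_id] at hdet
  have hne : Gen.Nonempty := by
    by_contra hne
    rw [Finset.not_nonempty_iff_eq_empty] at hne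
    rw [hne, Finset.sum_empty] at hdet
    exact h0 hdet
  rw [← hcard] at h
  -- With `u` the sign of the determinant, every `u * term` is at most 1, while their sum is at
  -- least the number of terms; so all equal 1.
  obtain ⟨u, hu⟩ : ∃ u : ℤˣ, ∀ κ ∈ Gen, term row ε κ = u := by
    set d := (mat row ε fun _ _ => (1 : ℤ)).det with hd
    obtain ⟨u, hu⟩ : ∃ u : ℤˣ, (d.natAbs : ℤ) = u * d := by
      rcases le_total 0 d with h | h
      · exact ⟨1, by simp [abs_of_nonneg h]⟩
      · exact ⟨-1, by simp [abs_of_nonpos h]⟩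
    refine ⟨u, ?_⟩
    have hle : ∀ κ ∈ Gen, (u : ℤ) * term row ε κ ≤ 1 := by
      intro κ hκ
      obtain ⟨v, hv⟩ := term_eq_unit row ε (Finset.mem_filter.1 hκ).2
      rw [hv, ← Units.val_mul]
      rcases Int.units_eq_one_or (u * v) with h | h <;> simp [h]
    have heq : ∑ κ ∈ Gen, (u : ℤ) * term row ε κ = ∑ κ ∈ Gen, 1 := by
      refine le_antisymm (Finset.sum_le_sum hle) ?_
      rw [← Finset.mul_sum, ← hdet, ← hu]
      rw [Finset.sum_const, nsmul_one]
      exact_mod_cast h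
    intro κ hκ
    have h1 := (Finset.sum_eq_sum_iff_of_le hle).1 heq κ hκ
    have h2 : (u : ℤ) * u = 1 := by rw [← Units.val_mul, Int.units_mul_self]; rfl
    calc term row ε κ = (u * u) * term row ε κ := by rw [h2, one_mul]
      _ = u := by rw [mul_assoc, h1, mul_one]
  rw [hsum, Finset.sum_congr rfl fun κ hκ => by rw [hu κ hκ], ← Finset.sum_mul]
  refine mul_ne_zero (Finset.sum_pos (fun κ _ => Finset.prod_pos fun j _ => hc _ _) hne).ne' ?_
  exact_mod_cast u.ne_zero

end LetterMatrix

/-- Weight the positive entries by the total of the negative parts and the remaining ones by the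
total of the positive parts. -/
theorem exists_pos_weights {L : Type*} [Fintype L] (t : L → ℝ)
    (h : (∀ l, t l = 0) ∨ (∃ l, 0 < t l) ∧ ∃ l, t l < 0) :
    ∃ c : L → ℝ, (∀ l, 0 < c l) ∧ ∑ l, c l * t l = 0 := by
  rcases h with h | ⟨⟨p, hp⟩, q, hq⟩
  · exact ⟨fun _ => 1, fun _ => one_pos, by simp [h]⟩
  · let P := ∑ l, (t l)⁺
    let N := ∑ l, (t l)⁻
    have hP : 0 < P := Finset.sum_pos' (fun l _ => posPart_nonneg _) ⟨p, Finset.mem_univ _, by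
      simpa using hp⟩
    have hN : 0 < N := Finset.sum_pos' (fun l _ => negPart_nonneg _) ⟨q, Finset.mem_univ _, by
      simpa using hq⟩
    refine ⟨fun l => if 0 < t l then N else P, fun l => by dsimp only; split_ifs <;> assumption, ?_⟩
    have : ∀ l, (if 0 < t l then N else P) * t l = N * (t l)⁺ - P * (t l)⁻ := by
      intro l
      split_ifs with hl
      · rw [posPart_of_nonneg hl.le, negPart_of_nonneg hl.le]; ring
      · rw [posPart_of_nonpos (not_lt.1 hl), negPart_of_nonpos (not_lt.1 hl)]; ring
    rw [Finset.sum_congr rfl fun l _ => this l, Finset.sum_sub_distrib, ← Finset.mul_sum,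
      ← Finset.mul_sum]
    change N * P - P * N = 0
    ring

section Order

variable {Γ : Type*} [Group Γ] (lt : Γ → Γ → Prop) [IsStrictTotalOrder Γ lt]

/-- If the tail has product ≥ 1, left invariance gives a ≤ a · tail. So the product is at least its
first factor, and induction on the tail needs no right invariance. -/
theorem List.eq_one_of_prod_eq_one_of_left_invariant
    (hlt : ∀ g h k : Γ, lt g h → lt (k * g) (k * h)) (w : List Γ) (hw : ∀ a ∈ w, ¬ lt a 1)
    (h : w.prod = 1) : ∀ a ∈ w, a = 1 := by
  have key : ∀ w : List Γ, (∀ a ∈ w, ¬ lt a 1) →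
      (¬ lt w.prod 1) ∧ (w.prod = 1 → ∀ a ∈ w, a = 1) := by
    intro w
    induction w with
    | nil => exact fun _ => ⟨by simpa using irrefl_of lt (1 : Γ), by simp⟩
    | cons a w ih =>
      intro hw
      obtain ⟨h1, h2⟩ := ih fun b hb => hw b (List.mem_cons_of_mem _ hb)
      have ha := hw a List.mem_cons_self
      have hle : a * w.prod = a ∨ lt a (a * w.prod) := by
        rcases trichotomous_of lt w.prod 1 with h | h | h
        · exact (h1 h).elim
        · exact .inl (by rw [h, mul_one])
        · exact .inr (by simpa using hlt _ _ a h)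
      rw [List.prod_cons]
      refine ⟨fun h => ?_, fun h => ?_⟩
      · rcases hle with h' | h'
        · exact ha (h' ▸ h)
        · exact ha (trans_of lt h' h)
      · have ha1 : a = 1 := by
          rcases hle with h' | h'
          · exact h'.symm.trans h
          · exact (ha (h ▸ h')).elim
        subst ha1
        rw [one_mul] at h
        simpa using h2 h
  exact (key w hw).2 h

open Classical in
/-- The sign of an element with respect to a left order. -/
def orderSign (a : Γ) : ℤ := if lt 1 a then 1 else if lt a 1 then -1 else 0

theorem orderSign_eq_zero {a : Γ} : orderSign lt a = 0 ↔ a = 1 := by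
  unfold orderSign
  rcases trichotomous_of lt a 1 with h | h | h
  · simp [h, asymm_of lt h, ne_of_irrefl h]
  · simp [h, irrefl_of lt]
  · simp [h, ne_of_irrefl' h]

theorem orderSign_neg {a : Γ} : orderSign lt a < 0 ↔ lt a 1 := by
  unfold orderSign
  rcases trichotomous_of lt a 1 with h | h | h
  · simp [h, asymm_of lt h]
  · simp [h, irrefl_of lt]
  · simp [h, asymm_of lt h]

theorem orderSign_pos {a : Γ} : 0 < orderSign lt a ↔ lt 1 a := by
  unfold orderSign
  rcases trichotomous_of lt a 1 with h | h | h
  · simp [h, asymm_of lt h]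
  · simp [h, irrefl_of lt]
  · simp [h]

theorem orderSign_zpow (hlt : ∀ g h k : Γ, lt g h → lt (k * g) (k * h)) (a : Γ) (ε : ℤˣ) :
    orderSign lt (a ^ (ε : ℤ)) = ε * orderSign lt a := by
  rcases Int.units_eq_one_or ε with rfl | rfl
  · simp
  · have h1 : lt 1 a → lt a⁻¹ 1 := fun h => by simpa using hlt _ _ a⁻¹ h
    have h2 : lt a 1 → lt 1 a⁻¹ := fun h => by simpa using hlt _ _ a⁻¹ h
    have h3 : ((-1 : ℤˣ) : ℤ) = -1 := rfl
    rw [h3, zpow_neg_one]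
    unfold orderSign
    rcases trichotomous_of lt a 1 with h | h | h
    · simp [h, asymm_of lt h, h2 h]
    · simp [h, irrefl_of lt]
    · simp [h, h1 h, asymm_of lt (h1 h)]

end Order

/-- The exponent sum of a generator in a word. -/
def expSum {n P : Type*} [DecidableEq n] (w : List (n × ℤˣ × P)) (i : n) : ℤ :=
  (w.map fun l => if l.1 = i then (l.2.1 : ℤ) else 0).sum

theorem prod_map_zpow_eq_prod_expSum {n P A : Type*} [Fintype n] [DecidableEq n] [CommGroup A]
    (a : n → A) (w : List (n × ℤˣ × P)) :
    (w.map fun l => a l.1 ^ (l.2.1 : ℤ)).prod = ∏ i, a i ^ expSum w i := by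
  induction w with
  | nil => simp [expSum]
  | cons l w ih =>
    have : ∀ i, expSum (l :: w) i = (if l.1 = i then (l.2.1 : ℤ) else 0) + expSum w i := fun i => by
      simp [expSum]
    simp_rw [List.map_cons, List.prod_cons, ih, this, zpow_add, Finset.prod_mul_distrib]
    congr 1
    rw [Finset.prod_eq_single l.1 (fun i _ hi => by simp [hi.symm]) (by simp)]
    simp

theorem mat_eq_expSum {n P : Type*} [Fintype n] [DecidableEq n] (w : n → List (n × ℤˣ × P)) :
    LetterMatrix.mat (L := fun j => Fin (w j).length) (fun j l => ((w j).get l).1)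
      (fun j l => ((w j).get l).2.1) (fun _ _ => (1 : ℤ)) = fun j i => expSum (w j) i := by
  ext j i
  rw [LetterMatrix.mat, expSum, ← Fin.sum_univ_fun_getElem, Finset.sum_apply]
  refine Finset.sum_congr rfl fun l _ => ?_
  simp [Pi.single_apply, eq_comm]

/-- A nontrivial group generated by `x` which satisfies relations with maximal determinant is not
left-orderable. -/
theorem not_leftOrderable_of_words {n P Γ : Type*} [Fintype n] [DecidableEq n] [Group Γ]
    (x : n → Γ) (hx : Subgroup.closure (range x) = ⊤) (w : n → List (n × ℤˣ × P))
    (hw : ∀ j, ((w j).map fun l => x l.1 ^ (l.2.1 : ℤ)).prod = 1)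
    (h0 : Matrix.det (fun j i => expSum (w j) i) ≠ 0)
    (h : Nat.card {κ : ∀ j, Fin (w j).length //
        Function.Injective fun j => ((w j).get (κ j)).1} ≤
      (Matrix.det fun j i => expSum (w j) i).natAbs) : ¬ LeftOrderable Γ := by
  rintro ⟨hΓ, lt, hlt, hinv⟩
  rw [← mat_eq_expSum] at h0 h
  let s : n → ℝ := fun i => orderSign lt (x i)
  let t : ∀ j, Fin (w j).length → ℝ := fun j l => (((w j).get l).2.1 : ℤ) * s ((w j).get l).1
  have ht : ∀ j l, t j l = orderSign lt (x ((w j).get l).1 ^ (((w j).get l).2.1 : ℤ)) := by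
    intro j l
    rw [orderSign_zpow lt hinv]
    push_cast; rfl
  have hmem : ∀ j, ∀ a ∈ (w j).map fun l => x l.1 ^ (l.2.1 : ℤ),
      ∃ l, a = x ((w j).get l).1 ^ (((w j).get l).2.1 : ℤ) := by
    intro j a ha
    obtain ⟨l, hl, rfl⟩ := List.mem_map.1 ha
    obtain ⟨k, rfl⟩ := List.get_of_mem hl
    exact ⟨k, rfl⟩
  have hmem' : ∀ j l, x ((w j).get l).1 ^ (((w j).get l).2.1 : ℤ) ∈
      (w j).map fun l => x l.1 ^ (l.2.1 : ℤ) := fun j l =>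
    List.mem_map.2 ⟨_, List.get_mem _ _, rfl⟩
  have hbal : ∀ j, (∀ l, t j l = 0) ∨ (∃ l, 0 < t j l) ∧ ∃ l, t j l < 0 := by
    intro j
    by_cases hp : ∃ l, 0 < t j l
    · by_cases hn : ∃ l, t j l < 0
      · exact .inr ⟨hp, hn⟩
      · left
        have := List.eq_one_of_prod_eq_one_of_left_invariant lt hinv _ (fun a ha hlt => by
          obtain ⟨l, rfl⟩ := hmem j a ha
          exact hn ⟨l, by rw [ht]; exact_mod_cast (orderSign_neg lt).2 hlt⟩) (hw j)
        intro l
        rw [ht, (orderSign_eq_zero lt).2 (this _ (hmem' j l)), Int.cast_zero]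
    · left
      -- The reversed order is again left-invariant and exchanges the two signs.
      have := List.eq_one_of_prod_eq_one_of_left_invariant (Function.swap lt)
        (fun g h k => hinv h g k) _ (fun a ha hlt => by
          obtain ⟨l, rfl⟩ := hmem j a ha
          exact hp ⟨l, by rw [ht]; exact_mod_cast (orderSign_pos lt).2 hlt⟩) (hw j)
      intro l
      rw [ht, (orderSign_eq_zero lt).2 (this _ (hmem' j l)), Int.cast_zero]
  choose c hc hsum using fun j => exists_pos_weights (t j) (hbal j)
  -- The sign vector is a kernel vector of the weighted matrix; it is nonzero because the group is
  -- nontrivial.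
  refine LetterMatrix.det_mat_ne_zero _ _ h0 h hc (Matrix.exists_mulVec_eq_zero_iff.1 ⟨s, ?_, ?_⟩)
  · intro hs
    have hx1 : ∀ i, x i = 1 := fun i => by
      have : (orderSign lt (x i) : ℝ) = 0 := congrFun hs i
      exact (orderSign_eq_zero lt).1 (by exact_mod_cast this)
    have : (⊤ : Subgroup Γ) = ⊥ := by
      rw [← hx, Subgroup.closure_eq_bot_iff]
      rintro _ ⟨i, rfl⟩
      exact hx1 i
    obtain ⟨a, ha⟩ := exists_ne (1 : Γ)
    exact ha (Subgroup.mem_bot.1 (this ▸ Subgroup.mem_top a))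
  · ext j
    rw [Pi.zero_apply, ← hsum j]
    simp only [Matrix.mulVec, dotProduct, LetterMatrix.mat, Finset.sum_apply, Finset.sum_mul]
    rw [Finset.sum_comm]
    refine Finset.sum_congr rfl fun l _ => ?_
    rw [Finset.sum_eq_single ((w j).get l).1]
    · simp [t, mul_assoc]
    · intro i _ hi
      rw [List.get_eq_getElem] at hi
      simp [hi]
    · simp

end

/-! ### Lifting and extending circle-valued maps. -/

noncomputable section

open Topology unitInterval Set

namespace AddCircle

theorem exists_lift_of_isQuotientMap {A B : Type*} [TopologicalSpace A] [TopologicalSpace B]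
    {q : A → B} (hq : IsQuotientMap q) (F : C(B, AddCircle (1 : ℝ))) (L : C(A, ℝ))
    (hL : ∀ a, (L a : AddCircle (1 : ℝ)) = F (q a)) (hc : ∀ a a', q a = q a' → L a = L a') :
    ∃ L' : C(B, ℝ), ∀ b, (L' b : AddCircle (1 : ℝ)) = F b := by
  have hf : Function.FactorsThrough L q := fun a a' h => hc a a' h
  refine ⟨hq.lift (f := ⟨q, hq.continuous⟩) L hf, fun b => ?_⟩
  obtain ⟨a, rfl⟩ := hq.surjective b
  rw [← hL]
  congr 1
  exact congrArg (fun f : C(A, ℝ) => f a) (hq.lift_comp (f := ⟨q, hq.continuous⟩) L hf)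

/-- A map from a thickened circle to the circle which has degree zero lifts to the line. -/
theorem exists_lift_circle_prod {K : Type*} [TopologicalSpace K] [ContractibleSpace K]
    [LocallyPathConnectedSpace K] (F : C(Circle × K, AddCircle (1 : ℝ))) (z : Circle) (k : K)
    (h : (liftHolonomy F).hol (circlePath ⟨fun z => (z, k), by fun_prop⟩ z) = 1) :
    ∃ L : C(Circle × K, ℝ), ∀ a, (L a : AddCircle (1 : ℝ)) = F a := by
  let q : ℝ × K → Circle × K := Prod.map Circle.exp id
  have hqc : Continuous q := Circle.exp.continuous.prodMap continuous_id
  have hq : IsQuotientMap q :=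
    (isLocalHomeomorph_circleExp.isOpenMap.prodMap IsOpenMap.id).isQuotientMap hqc
      (Circle.exp_surjective.prodMap Function.surjective_id)
  obtain ⟨L, hL⟩ := exists_lift (F.comp ⟨q, hqc⟩)
  -- The lift and its translate by a period lift the same map, so they differ by a constant, which
  -- the degree on one circle shows to be zero.
  have hper : ∀ p : ℝ × K, L (p.1 + 2 * Real.pi, p.2) = L p := by
    have h1 : ∀ p p' : ℝ × K, L (p'.1 + 2 * Real.pi, p'.2) - L (p.1 + 2 * Real.pi, p.2) =
        L p' - L p := by
      intro p p'
      refine lift_sub_eq (L := fun p : ℝ × K => L (p.1 + 2 * Real.pi, p.2)) (by fun_prop)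
        L.continuous (fun p => ?_) p p'
      rw [hL, hL]
      simp [q, Prod.map]
    obtain ⟨s, hs⟩ := Circle.exp_surjective z
    have h2 := liftHolonomy_hol F (circlePath ⟨fun z => (z, k), by fun_prop⟩ z)
      (L := fun t => L (s + 2 * Real.pi * t, k)) (by fun_prop) fun t => by
        rw [hL, circlePath_apply]
        simp [q, hs, Circle.exp_add]
    rw [h] at h2
    have h3 : L (s + 2 * Real.pi, k) - L (s, k) = 0 := by
      simpa using congrArg Multiplicative.toAdd h2.symm
    intro p
    have := h1 (s, k) p
    simp only at this
    linarith
  refine exists_lift_of_isQuotientMap hq F L hL ?_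
  rintro ⟨s, k⟩ ⟨s', k'⟩ he
  have he1 : Circle.exp s = Circle.exp s' := congrArg Prod.fst he
  obtain rfl : k = k' := congrArg Prod.snd he
  obtain ⟨m, rfl⟩ := Circle.exp_eq_exp.1 he1
  have hp : Function.Periodic (fun s => L (s, k)) (2 * Real.pi) := fun s => hper (s, k)
  exact hp.int_mul m s'

/-- Tietze's theorem applies to the real-valued lift. -/
theorem exists_extension_of_lift {A C : Type*} [TopologicalSpace A] [TopologicalSpace C]
    [NormalSpace C] {φ : A → C} (hφ : IsClosedEmbedding φ) (F : C(A, AddCircle (1 : ℝ)))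
    (L : C(A, ℝ)) (hL : ∀ a, (L a : AddCircle (1 : ℝ)) = F a) :
    ∃ G : C(C, AddCircle (1 : ℝ)), ∀ a, G (φ a) = F a := by
  obtain ⟨M, hM⟩ := L.exists_extension hφ
  refine ⟨⟨fun c => (M c : AddCircle (1 : ℝ)), (AddCircle.continuous_mk' 1).comp M.continuous⟩, fun a => ?_⟩
  rw [← hL]
  exact congrArg (fun f : C(A, ℝ) => (f a : AddCircle (1 : ℝ))) hM

/-- The map collapsing the ends of a cylinder to the poles of the sphere. -/
def suspensionMap (a : Circle × Icc (-1 : ℝ) 1) : Metric.sphere (0 : EuclideanSpace ℝ (Fin 3)) 1 :=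
  ⟨!₂[√(1 - (a.2 : ℝ) ^ 2) * (a.1 : ℂ).re, √(1 - (a.2 : ℝ) ^ 2) * (a.1 : ℂ).im, a.2], by
    have h1 : 0 ≤ 1 - (a.2 : ℝ) ^ 2 := by nlinarith [a.2.2.1, a.2.2.2]
    have h2 : (a.1 : ℂ).re ^ 2 + (a.1 : ℂ).im ^ 2 = 1 := by
      have := Circle.normSq_coe a.1
      rw [Complex.normSq_apply] at this
      linarith
    rw [mem_sphere_zero_iff_norm, EuclideanSpace.norm_eq, Fin.sum_univ_three]
    simp only [Real.norm_eq_abs, sq_abs, Matrix.cons_val]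
    rw [mul_pow, mul_pow, Real.sq_sqrt h1]
    rw [show ∀ x y z : ℝ, z * x + z * y + (a.2 : ℝ) ^ 2 = z * (x + y) + (a.2 : ℝ) ^ 2 by
      intros; ring, h2]
    simp⟩

theorem continuous_suspensionMap : Continuous suspensionMap := by
  refine Continuous.subtype_mk ((PiLp.continuous_toLp 2 _).comp (continuous_pi fun i => ?_)) _
  fin_cases i <;> simp <;> fun_prop

theorem suspensionMap_surjective : Function.Surjective suspensionMap := by
  rintro ⟨x, hx⟩
  rw [mem_sphere_zero_iff_norm] at hx
  have hx2 : x 0 ^ 2 + x 1 ^ 2 + x 2 ^ 2 = 1 := by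
    have := EuclideanSpace.norm_sq_eq x
    rw [hx, Fin.sum_univ_three] at this
    simpa using this.symm
  have ht : x 2 ∈ Icc (-1 : ℝ) 1 := abs_le.1 ((sq_le_one_iff_abs_le_one _).1 (by nlinarith))
  let w : ℂ := ⟨x 0, x 1⟩
  have hw : ‖w‖ = √(1 - x 2 ^ 2) := by
    rw [Complex.norm_def, Complex.normSq_apply]
    congr 1
    simp only [w]
    linarith
  obtain ⟨z, hz⟩ : ∃ z : Circle, (‖w‖ : ℂ) * z = w := by
    refine ⟨Circle.exp w.arg, ?_⟩
    rw [Circle.coe_exp, Complex.norm_mul_exp_arg_mul_I]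
  refine ⟨(z, ⟨x 2, ht⟩), Subtype.ext ?_⟩
  ext i
  have hre : ‖w‖ * (z : ℂ).re = x 0 := by simpa using congrArg Complex.re hz
  have him : ‖w‖ * (z : ℂ).im = x 1 := by simpa using congrArg Complex.im hz
  fin_cases i
  · simpa [suspensionMap, ← hw] using hre
  · simpa [suspensionMap, ← hw] using him
  · simp [suspensionMap]

theorem suspensionMap_eq {a a' : Circle × Icc (-1 : ℝ) 1} (h : suspensionMap a = suspensionMap a') :
    a.2 = a'.2 ∧ (a.1 = a'.1 ∨ |(a.2 : ℝ)| = 1) := by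
  have h' : ∀ i, (suspensionMap a : EuclideanSpace ℝ (Fin 3)) i =
    (suspensionMap a' : EuclideanSpace ℝ (Fin 3)) i := fun i => by rw [h]
  have h2 : a.2 = a'.2 := Subtype.ext (by simpa [suspensionMap] using h' 2)
  refine ⟨h2, or_iff_not_imp_right.2 fun ha => ?_⟩
  have h1 : 0 < 1 - (a.2 : ℝ) ^ 2 := by
    have hle : |(a.2 : ℝ)| ≤ 1 := abs_le.2 a.2.2
    have := sq_lt_one_iff_abs_lt_one _ |>.2 (lt_of_le_of_ne hle ha)
    linarith
  have hs : √(1 - (a.2 : ℝ) ^ 2) ≠ 0 := (Real.sqrt_pos.2 h1).ne'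
  refine Circle.ext (Complex.ext ?_ ?_)
  · exact mul_left_cancel₀ hs (by simpa [suspensionMap, ← h2] using h' 0)
  · exact mul_left_cancel₀ hs (by simpa [suspensionMap, ← h2] using h' 1)

theorem suspensionMap_of_end (t : Icc (-1 : ℝ) 1) (ht : |(t : ℝ)| = 1) (z z' : Circle) :
    suspensionMap (z, t) = suspensionMap (z', t) := by
  have : √(1 - (t : ℝ) ^ 2) = 0 := by rw [← sq_abs, ht]; simp
  apply Subtype.ext
  simp [suspensionMap, this]

/-- On the cylinder over the sphere the map is constant on an end circle, so it has degree zero and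
lifts. The lift is constant on each end circle, being a lift of a constant, and so descends to the
sphere. -/
theorem exists_lift_sphere
    (F : C(Metric.sphere (0 : EuclideanSpace ℝ (Fin 3)) 1, AddCircle (1 : ℝ))) :
    ∃ L : C(Metric.sphere (0 : EuclideanSpace ℝ (Fin 3)) 1, ℝ),
      ∀ a, (L a : AddCircle (1 : ℝ)) = F a := by
  have hq : IsQuotientMap suspensionMap :=
    continuous_suspensionMap.isClosedMap.isQuotientMap continuous_suspensionMap
      suspensionMap_surjective
  have : ContractibleSpace (Icc (-1 : ℝ) 1) := (convex_Icc _ _).contractibleSpace ⟨0, by simp⟩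
  have : LocallyPathConnectedSpace (Icc (-1 : ℝ) 1) := (convex_Icc _ _).locallyPathConnectedSpace
  let F' := F.comp ⟨_, continuous_suspensionMap⟩
  have htop : |((Handle3.top : Icc (-1 : ℝ) 1) : ℝ)| = 1 := by rw [Handle3.top]; norm_num
  obtain ⟨r, hr⟩ := QuotientAddGroup.mk_surjective (F' (1, Handle3.top))
  obtain ⟨L, hL⟩ := exists_lift_circle_prod F' 1 Handle3.top (by
    rw [liftHolonomy_hol F' _ (L := fun _ => r) continuous_const fun t => ?_]
    · simp
    · refine hr.trans (congrArg F ?_)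
      exact suspensionMap_of_end _ htop _ _)
  refine exists_lift_of_isQuotientMap hq F L hL ?_
  rintro ⟨z, t⟩ ⟨z', t'⟩ h
  obtain ⟨h2, h1⟩ := suspensionMap_eq h
  obtain rfl : t = t' := h2
  rcases h1 with h1 | h1
  · obtain rfl : z = z' := h1
    rfl
  · have : PreconnectedSpace Circle := inferInstance
    obtain ⟨r, hr⟩ := QuotientAddGroup.mk_surjective (F (suspensionMap (z, t)))
    have := lift_sub_eq (Z := Circle) (L := fun z => L (z, t)) (L' := fun _ => r) (by fun_prop)
      continuous_const (fun z' => by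
        rw [hL]
        exact (congrArg F (suspensionMap_of_end t h1 z' z)).trans hr.symm) z z'
    simp only [sub_self] at this
    linarith

end AddCircle

theorem Topology.IsEmbedding.continuousOn_range {C Y Z : Type*} [TopologicalSpace C]
    [TopologicalSpace Y] [TopologicalSpace Z] {j : C → Y} (hj : IsEmbedding j) {f : Y → Z}
    (hf : Continuous (f ∘ j)) : ContinuousOn f (range j) := by
  rintro _ ⟨c, rfl⟩
  rw [ContinuousWithinAt, ← hj.map_nhds_eq]
  exact hf.tendsto c

/-- Extending a continuous map over finitely many disjoint compact pieces. -/
theorem ContinuousOn.exists_extend_of_isEmbedding {ι C Y Z : Type*} [Finite ι] [TopologicalSpace C]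
    [CompactSpace C] [TopologicalSpace Y] [T2Space Y] [TopologicalSpace Z] {j : ι → C → Y}
    (hj : ∀ i, IsEmbedding (j i)) (hd : Pairwise fun i k => Disjoint (range (j i)) (range (j k)))
    {F : Set Y} (hFc : IsClosed F) {f : Y → Z} (hf : ContinuousOn f F) (G : ι → C(C, Z))
    (hG : ∀ i c, j i c ∈ F → G i c = f (j i c)) :
    ∃ f' : Y → Z, EqOn f f' F ∧ (∀ i c, f' (j i c) = G i c) ∧
      ContinuousOn f' (F ∪ ⋃ i, range (j i)) := by
  let J : ι × C → Y := fun a => j a.1 a.2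
  have hJ : Function.Injective J := by
    rintro ⟨i, c⟩ ⟨k, d⟩ h
    obtain rfl : i = k := by
      by_contra hik
      exact disjoint_left.1 (hd hik) ⟨c, rfl⟩ ⟨d, h.symm⟩
    obtain rfl : c = d := (hj i).injective h
    rfl
  let f' : Y → Z := Function.extend J (fun a => G a.1 a.2) f
  have hf'j : ∀ i c, f' (j i c) = G i c := fun i c => hJ.extend_apply _ _ (i, c)
  have hF : EqOn f f' F := by
    intro p hp
    by_cases h : ∃ a, J a = p
    · obtain ⟨⟨i, c⟩, rfl⟩ := h
      exact (hG i c hp).symm.trans (hf'j i c).symm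
    · exact (Function.extend_apply' _ _ _ h).symm
  have hcl : ∀ i, IsClosed (range (j i)) := fun i =>
    (isCompact_range (hj i).continuous).isClosed
  refine ⟨f', hF, hf'j, (hf.congr hF.symm).union_of_isClosed
    ((locallyFinite_of_finite _).continuousOn_iUnion hcl fun i => ?_) hFc
    (isClosed_iUnion_of_finite hcl)⟩
  refine (hj i).continuousOn_range ((G i).continuous.congr fun c => (hf'j i c).symm)

end

/-! ### The presentation matrix and the first homology. -/

noncomputable section

open Topology unitInterval Set

namespace Handlebody

open Handle3

variable {g : ℕ} {X : Type*} [TopologicalSpace X] {D : Handlebody g X}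
  {Γ : Type*} [Group Γ] {H : Holonomy X Γ}

theorem gen_mapGroup {Γ' : Type*} [Group Γ'] (φ : Γ →* Γ') (i : Fin g) :
    D.gen (H.mapGroup φ) i = φ (D.gen H i) := by
  simp only [gen, side, map_mul, map_inv]
  rfl

theorem eval_mapGroup {Γ' : Type*} [Group Γ'] (φ : Γ →* Γ') (w : List (Fin g × ℤˣ × Circle)) :
    D.eval (H.mapGroup φ) w = φ (D.eval H w) := by
  rw [eval, eval, map_list_prod, List.map_map]
  congr 2
  ext l
  simp [gen_mapGroup]

/-- Without holonomy around loops the transport is a coboundary, and the handle loop telescopes. -/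
theorem gen_eq_one_of_forall_loop [PathConnectedSpace X] {y : X}
    (h : ∀ γ : Path y y, H.hol γ = 1) (i : Fin g) : D.gen H i = 1 := by
  let L : X → Γ := fun p => H.hol (PathConnectedSpace.somePath y p)
  have hL : ∀ {p q : X} (γ : Path p q), H.hol γ = L q * (L p)⁻¹ := by
    intro p q γ
    have h1 := h (((PathConnectedSpace.somePath y p).trans γ).trans
      (PathConnectedSpace.somePath y q).symm)
    have h2 := h ((PathConnectedSpace.somePath y q).trans (PathConnectedSpace.somePath y q).symm)
    rw [H.hol_trans] at h2
    rw [H.hol_trans, H.hol_trans, eq_inv_of_mul_eq_one_left h2] at h1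
    rw [eq_mul_inv_iff_mul_eq]
    exact (inv_mul_eq_one.1 h1).symm
  have hside : ∀ ε : Icc (-1 : ℝ) 1, |(ε : ℝ)| = 1 → ∀ c,
      D.side H ε i c = L (D.h i c) * (L (D.b Ball3.center))⁻¹ := by
    intro ε hε c
    have h1 : D.trH H i (axis ε) c = L (D.h i c) * (L (D.h i (axis ε)))⁻¹ := hL _
    have h2 : D.trB H Ball3.center (D.foot i ε) =
      L (D.b (D.foot i ε)) * (L (D.b Ball3.center))⁻¹ := hL _
    rw [side, h1, h2, b_foot hε]
    group
  rw [gen, hside bot (by rw [bot]; norm_num), hside top (by rw [top]; norm_num), inv_mul_cancel]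

/-- The sign arises because the handle loop enters at the top and leaves at the bottom, with
decreasing height. -/
theorem gen_liftHolonomy {f : C(X, AddCircle (1 : ℝ))} {v : Fin g → ℤ} (hb : ∀ d, f (D.b d) = 0)
    (hh : ∀ i c, f (D.h i c) = ((v i * (((c.2 : ℝ) + 1) / 2) : ℝ) : AddCircle (1 : ℝ)))
    (i : Fin g) : D.gen (liftHolonomy f) i = Multiplicative.ofAdd (-(v i : ℝ)) := by
  have h1 : ∀ c d, D.trB (liftHolonomy f) c d = 1 := by
    intro c d
    refine (liftHolonomy_hol f _ (L := fun _ => 0) continuous_const fun t => (hb _).symm).trans ?_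
    simp
  have h2 : ∀ c d, D.trH (liftHolonomy f) i c d =
      Multiplicative.ofAdd ((v i : ℝ) * (((d.2 : ℝ) - c.2) / 2)) := by
    intro c d
    refine (liftHolonomy_hol f _
      (L := fun t => v i * ((((PathConnectedSpace.somePath c d t).2 : ℝ) + 1) / 2))
      (by fun_prop) fun t => (hh _ _).symm).trans ?_
    congr 1
    simp only [Path.source, Path.target]
    ring
  simp only [gen, side, h1, h2, mul_one]
  rw [← ofAdd_neg, ← ofAdd_add]
  congr 1
  simp only [axis, top, bot, mid]
  ring

theorem eval_liftHolonomy {f : C(X, AddCircle (1 : ℝ))} {v : Fin g → ℤ} (hb : ∀ d, f (D.b d) = 0)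
    (hh : ∀ i c, f (D.h i c) = ((v i * (((c.2 : ℝ) + 1) / 2) : ℝ) : AddCircle (1 : ℝ)))
    (w : List (Fin g × ℤˣ × Circle)) (hw : ∑ i, expSum w i * v i = 0) :
    D.eval (liftHolonomy f) w = 1 := by
  rw [eval, prod_map_zpow_eq_prod_expSum]
  simp only [gen_liftHolonomy hb hh, ← ofAdd_zsmul, ← ofAdd_sum]
  rw [ofAdd_eq_one]
  have : ((∑ i, expSum w i * v i : ℤ) : ℝ) = 0 := by rw [hw, Int.cast_zero]
  push_cast at this
  simp [this]

end Handlebody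

namespace HeegaardSplitting

open Handlebody Handle3

theorem union_range_b' {g : ℕ} {Y : Type*} [TopologicalSpace Y] {T : HeegaardSplitting g Y} :
    (T.D.carrier ∪ ⋃ i, range (T.D'.h i)) ∪ ⋃ _ : Unit, range T.D'.b = univ := by
  refine eq_univ_of_forall fun p => ?_
  have hp : p ∈ T.D.carrier ∪ T.D'.carrier := T.union ▸ mem_univ p
  rcases hp with hp | hp | hp
  · exact .inl (.inl hp)
  · exact .inr (mem_iUnion.2 ⟨(), hp⟩)
  · exact .inl (.inr hp)

variable {g : ℕ} {Y : Type u} [TopologicalSpace Y] {T : HeegaardSplitting g Y}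

/-- The words `w j` spell the attaching curves of the second handlebody in the first. -/
def Spells (T : HeegaardSplitting g Y) (w : Fin g → List (Fin g × ℤˣ × Circle)) : Prop :=
  ∀ j, ∃ z : Circle, ∀ (Γ : Type u) [Group Γ] (H : Holonomy T.D.carrier Γ), ∃ c,
    H.hol (circlePath (T.curve j) z) = c * T.D.restrict.eval H (w j) * c⁻¹

theorem Spells.eval_eq_one {w : Fin g → List (Fin g × ℤˣ × Circle)} (hw : T.Spells w)
    {Γ : Type u} [Group Γ] (H : Holonomy Y Γ) (j : Fin g) : T.D.eval H (w j) = 1 := by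
  obtain ⟨z, hz⟩ := hw j
  obtain ⟨c, hc⟩ := hz Γ (H.pullback continuous_subtype_val)
  rw [hol_curve, restrict_eval] at hc
  simpa using hc.symm

variable [T2Space Y]

/-- An integral cocycle on the first handlebody which vanishes on the relators extends to the
whole space as a map to the circle. -/
theorem Spells.exists_circleMap {w : Fin g → List (Fin g × ℤˣ × Circle)} (hw : T.Spells w)
    (v : Fin g → ℤ) (hv : ∀ j, ∑ i, expSum (w j) i * v i = 0) :
    ∃ f : C(Y, AddCircle (1 : ℝ)), (∀ d, f (T.D.b d) = 0) ∧
      ∀ i c, f (T.D.h i c) = ((v i * (((c.2 : ℝ) + 1) / 2) : ℝ) : AddCircle (1 : ℝ)) := by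
  obtain ⟨f₀, he₀, hh₀, hf₀⟩ := ContinuousOn.exists_extend_of_isEmbedding T.D.isEmbedding_h
    T.D.disjoint isClosed_range_b (f := fun _ => (0 : AddCircle (1 : ℝ))) continuousOn_const
    (fun i => ⟨fun c => ((v i * (((c.2 : ℝ) + 1) / 2) : ℝ) : AddCircle (1 : ℝ)),
      (AddCircle.continuous_mk' 1).comp (by fun_prop)⟩) (by
      intro i c hc
      change ((v i * (((c.2 : ℝ) + 1) / 2) : ℝ) : AddCircle (1 : ℝ)) = 0
      rcases (abs_eq zero_le_one).1 (h_mem_range_b.1 hc) with h | h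
      · rw [h, AddCircle.coe_eq_zero_iff]
        exact ⟨v i, by norm_num⟩
      · rw [h]
        norm_num)
  have hb₀ : ∀ d, f₀ (T.D.b d) = 0 := fun d => (he₀ ⟨d, rfl⟩).symm
  let fU : C(T.D.carrier, AddCircle (1 : ℝ)) := ⟨fun p => f₀ p, hf₀.domRestrict⟩
  have hhol : ∀ j, ∃ z, (liftHolonomy fU).hol (circlePath (T.curve j) z) = 1 := by
    intro j
    obtain ⟨z, hz⟩ := hw j
    -- `Spells` quantifies over groups in the universe of `Y`, so the real holonomy is lifted there.
    let φ : Multiplicative ℝ ≃* ULift.{u} (Multiplicative ℝ) := MulEquiv.ulift.symm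
    obtain ⟨c, hc⟩ := hz _ ((liftHolonomy fU).mapGroup φ.toMonoidHom)
    rw [eval_mapGroup, eval_liftHolonomy (v := v) (fun d => hb₀ d) (fun i c => hh₀ i c) _ (hv j),
      map_one, mul_one, mul_inv_cancel] at hc
    exact ⟨z, φ.injective (hc.trans (map_one φ).symm)⟩
  have : ContractibleSpace (Icc (-1 : ℝ) 1) := (convex_Icc _ _).contractibleSpace ⟨0, by simp⟩
  have : LocallyPathConnectedSpace (Icc (-1 : ℝ) 1) := (convex_Icc _ _).locallyPathConnectedSpace
  have hG : ∀ j, ∃ G : C(Handle3, AddCircle (1 : ℝ)), ∀ a, G (annulus a) = f₀ (T.D'.h j (annulus a)) := by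
    intro j
    let φ : C(Circle × Icc (-1 : ℝ) 1, T.D.carrier) :=
      ⟨fun a => ⟨T.D'.h j (annulus a), mem_iff_h'.2 (norm_belt a.1)⟩,
        ((T.D'.isEmbedding_h j).continuous.comp isClosedEmbedding_annulus.continuous).subtype_mk _⟩
    obtain ⟨z, hz⟩ := hhol j
    -- Degree zero on the attaching curve is exactly what allows extension over the 2-handle.
    obtain ⟨L, hL⟩ := AddCircle.exists_lift_circle_prod (fU.comp φ) z mid hz
    exact AddCircle.exists_extension_of_lift isClosedEmbedding_annulus (fU.comp φ) L hL
  choose G hG using hG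
  obtain ⟨f₁, he₁, -, hf₁⟩ := ContinuousOn.exists_extend_of_isEmbedding T.D'.isEmbedding_h
    T.D'.disjoint isClosed_carrier hf₀ G (by
      intro j c hc
      obtain ⟨a, rfl⟩ := exists_annulus_eq (mem_iff_h'.1 hc)
      exact hG j a)
  let φ : Metric.sphere (0 : EuclideanSpace ℝ (Fin 3)) 1 → Ball3 :=
    inclusion Metric.sphere_subset_closedBall
  have hφ : IsClosedEmbedding φ :=
    (continuous_inclusion _).isClosedEmbedding (inclusion_injective _)
  have hφF : ∀ a, T.D'.b (φ a) ∈ T.D.carrier ∪ ⋃ i, range (T.D'.h i) := fun a =>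
    b'_mem_iff.2 (mem_sphere_zero_iff_norm.1 a.2)
  let F : C(Metric.sphere (0 : EuclideanSpace ℝ (Fin 3)) 1, AddCircle (1 : ℝ)) :=
    ⟨fun a => f₁ (T.D'.b (φ a)),
      hf₁.comp_continuous (T.D'.isEmbedding_b.continuous.comp hφ.continuous) hφF⟩
  obtain ⟨L, hL⟩ := AddCircle.exists_lift_sphere F
  obtain ⟨G', hG'⟩ := AddCircle.exists_extension_of_lift hφ F L hL
  obtain ⟨f₂, he₂, -, hf₂⟩ := ContinuousOn.exists_extend_of_isEmbedding (ι := Unit)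
    (j := fun _ => T.D'.b) (fun _ => T.D'.isEmbedding_b)
    (fun a b h => (h (Subsingleton.elim a b)).elim)
    (isClosed_carrier.union (isClosed_iUnion_of_finite isClosed_range_h)) hf₁ (fun _ => G') (by
      intro _ d hd
      exact hG' ⟨d, mem_sphere_zero_iff_norm.2 (b'_mem_iff.1 hd)⟩)
  rw [union_range_b', continuousOn_univ] at hf₂
  refine ⟨⟨f₂, hf₂⟩, fun d => ?_, fun i c => ?_⟩
  · change f₂ _ = _
    rw [← he₂ (.inl (b_mem_carrier d)), ← he₁ (b_mem_carrier d), hb₀]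
  · change f₂ _ = _
    rw [← he₂ (.inl (h_mem_carrier i c)), ← he₁ (h_mem_carrier i c), hh₀]
    rfl

/-- If the first homology is finite, the presentation matrix is nonsingular. -/
theorem Spells.det_ne_zero [PathConnectedSpace Y] [Finite (SingularH1 Y)] [Nonempty Y]
    {w : Fin g → List (Fin g × ℤˣ × Circle)} (hw : T.Spells w) :
    Matrix.det (fun j i => expSum (w j) i) ≠ 0 := by
  intro hdet
  obtain ⟨v, hv0, hv⟩ := Matrix.exists_mulVec_eq_zero_iff.2 hdet
  obtain ⟨f, hb, hh⟩ := hw.exists_circleMap v fun j => congrFun hv j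
  obtain ⟨ev, hev⟩ := SingularH1.exists_hom_of_circleMap f
  -- A finite group has no nonzero homomorphism to ℝ; hence all periods of `f`, and with them all `v
  -- i`, vanish.
  have hev0 : ∀ a, ev a = 0 := by
    intro a
    obtain ⟨n, hn, ha⟩ := (isOfFinAddOrder_of_finite a).exists_nsmul_eq_zero
    have := congrArg ev ha
    rw [map_nsmul, map_zero, nsmul_eq_mul, mul_eq_zero] at this
    exact this.resolve_left (by exact_mod_cast hn.ne')
  obtain ⟨y⟩ := ‹Nonempty Y›
  apply hv0
  ext i
  have h1 := gen_liftHolonomy hb hh i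
  rw [gen_eq_one_of_forall_loop (y := y) fun γ => ?_] at h1
  · have : -(v i : ℝ) = 0 := congrArg Multiplicative.toAdd h1.symm
    simpa using this
  · exact congrArg Multiplicative.ofAdd ((hev y γ).symm.trans (hev0 _))

/-- The Hurewicz images of the handle loops generate H₁ and satisfy the abelianized relators. -/
theorem Spells.card_le [PathConnectedSpace Y] [Finite (SingularH1 Y)]
    (hY : SemilocallySimplyConnected Y) (y : Y)
    {w : Fin g → List (Fin g × ℤˣ × Circle)} (hw : T.Spells w) :
    Nat.card (SingularH1 Y) ≤ (Matrix.det fun j i => expSum (w j) i).natAbs := by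
  let H := fundamentalHolonomy hY y
  let a : Fin g → SingularH1 Y := fun i => (SingularH1.hurewicz y (T.D.gen H i)).toAdd
  have : Nonempty Y := ⟨y⟩
  refine AddCommGroup.natCard_le_natAbs_det _ hw.det_ne_zero a ?_ fun j => ?_
  · have h1 := T.closure_gen_eq_top (H := H) (fundamentalHolonomy_surjective hY y)
    have h2 := congrArg (Subgroup.map (SingularH1.hurewicz y)) h1
    rw [MonoidHom.map_closure, Subgroup.map_top_of_surjective _
      (SingularH1.hurewicz_surjective y), ← range_comp] at h2
    have h3 : Subgroup.closure (range (SingularH1.hurewicz y ∘ T.D.gen H)) ≤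
        AddSubgroup.toSubgroup (AddSubgroup.closure (range a)) := by
      rw [Subgroup.closure_le]
      rintro _ ⟨i, rfl⟩
      exact (AddSubgroup.subset_closure ⟨i, rfl⟩ : a i ∈ AddSubgroup.closure (range a))
    exact eq_top_iff.2 fun x _ => h3 (h2 ▸ Subgroup.mem_top (Multiplicative.ofAdd x))
  · have h := congrArg (SingularH1.hurewicz y) (hw.eval_eq_one H j)
    rw [eval, map_list_prod, List.map_map, map_one] at h
    have h' := prod_map_zpow_eq_prod_expSum (fun i => SingularH1.hurewicz y (T.D.gen H i)) (w j)
    simp only [Function.comp_def, map_zpow] at h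
    rw [h] at h'
    simpa [a] using congrArg Multiplicative.toAdd h'.symm

/-- The fundamental group is not left-orderable if the number of terms in the determinant of the
presentation matrix does not exceed the order of the first homology. -/
theorem Spells.not_leftOrderable [PathConnectedSpace Y] [Finite (SingularH1 Y)]
    (hY : SemilocallySimplyConnected Y) (y : Y)
    {w : Fin g → List (Fin g × ℤˣ × Circle)} (hw : T.Spells w)
    (h : Nat.card {κ : ∀ j, Fin (w j).length //
        Function.Injective fun j => ((w j).get (κ j)).1} ≤ Nat.card (SingularH1 Y)) :
    ¬ LeftOrderable (FundamentalGroup Y y) :=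
  have : Nonempty Y := ⟨y⟩
  not_leftOrderable_of_words _ (T.closure_gen_eq_top (fundamentalHolonomy_surjective hY y)) w
    (hw.eval_eq_one _) hw.det_ne_zero (h.trans (hw.card_le hY y))

end HeegaardSplitting

end

/-! ### From Heegaard diagrams to words, and the conclusion. -/

noncomputable section

open Topology Set

open Handlebody Handle3

theorem IsHandlebodyWithBeltCircles.exists_handlebody {g : ℕ} {S Y : Type u} [TopologicalSpace S]
    [TopologicalSpace Y] {e : S → Y} {γ : Fin g → C(Circle, S)} {U : Set Y}
    (h : IsHandlebodyWithBeltCircles e γ U) : ∃ D : Handlebody g Y, D.carrier = U ∧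
      D.boundary = range e ∧ ∀ i z, D.h i (belt z) = e (γ i z) := by
  obtain ⟨b, h, hb, hh, hU, hd, hi, hs, he, hγ⟩ := h
  exact ⟨⟨b, h, hb, hh, hd, hi, hs⟩, hU.symm, he.symm, hγ⟩

/-- A free abelian group isomorphic to `ℤ ^ n` has a basis of `n` elements. -/
theorem finite_and_card_of_finsupp_equiv {ι : Type*} {n : ℕ} (e : (ι →₀ ℤ) ≃+ (Fin n → ℤ)) :
    Finite ι ∧ Nat.card ι = n := by
  have f : (ι →₀ ℤ) ≃ₗ[ℤ] (Fin n → ℤ) := e.toIntLinearEquiv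
  have : Module.Finite ℤ (ι →₀ ℤ) := Module.Finite.equiv f.symm
  have hfin : Finite ι := Module.Finite.finite_basis (Finsupp.basisSingleOne (R := ℤ) (ι := ι))
  refine ⟨hfin, ?_⟩
  have h := f.finrank_eq
  rwa [Module.finrank_eq_nat_card_basis (Finsupp.basisSingleOne (R := ℤ) (ι := ι)),
    Module.finrank_fin_fun] at h

namespace HeegaardDiagram

variable {g : ℕ} {S Y : Type u} [TopologicalSpace S]
  [ChartedSpace (EuclideanSpace ℝ (Fin 2)) S] [TopologicalSpace Y] [T2Space Y]

/-- A diagram of a space gives a splitting, with words whose letters are intersection points of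
the curves. -/
theorem IsDiagramOf.exists_splitting {H : HeegaardDiagram g S} (h : H.IsDiagramOf Y) :
    ∃ (T : HeegaardSplitting g Y) (w : Fin g → List (Fin g × ℤˣ × Circle)), T.Spells w ∧
      (∀ j, ((w j).map fun l => l.2.2).Nodup) ∧
      (∀ j, ∀ l ∈ w j, H.β j l.2.2 ∈ range (H.α l.1)) ∧
      (∀ j, Function.Injective (H.β j)) ∧
      Pairwise fun i j => Disjoint (range (H.β i)) (range (H.β j)) := by
  obtain ⟨e, U, V, he, hUV, hint, hU, hV⟩ := h
  obtain ⟨D, rfl, hDb, hDα⟩ := hU.exists_handlebody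
  obtain ⟨D', rfl, hDb', hDβ⟩ := hV.exists_handlebody
  let T : HeegaardSplitting g Y := ⟨D, D', hUV, hint.trans hDb.symm, hDb.trans hDb'.symm⟩
  have hw := fun j => exists_word_curve (D := D.restrict) (T.curve j)
    fun z => restrict_carrier (D := D) ▸ mem_univ _
  choose z w hnd hcore hH using hw
  refine ⟨T, w, fun j => ⟨z j, hH j⟩, hnd, fun j l hl => ?_, fun j z z' hz => ?_, fun i j hij => ?_⟩
  · obtain ⟨c, hc, hc'⟩ := hcore j l hl
    have hc' : D.h l.1 c = D'.h j (belt l.2.2) := congrArg Subtype.val hc'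
    obtain ⟨z', hz'⟩ := core_inter_boundary (D := D) ⟨c, hc, hc'⟩ (by
      rw [hDb, hDβ]
      exact ⟨_, rfl⟩)
    rw [hDα, hDβ] at hz'
    exact ⟨z', (he.injective hz').symm⟩
  · have : D'.h j (belt z) = D'.h j (belt z') := by rw [hDβ, hDβ, hz]
    exact belt_injective ((D'.isEmbedding_h j).injective this)
  · refine disjoint_left.2 ?_
    rintro _ ⟨z, rfl⟩ ⟨z', hz⟩
    have : D'.h i (belt z) = D'.h j (belt z') := by rw [hDβ, hDβ, hz]
    exact hij (h_inj this).1

/-- The terms of the determinant of the presentation matrix give distinct generators. -/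
theorem card_terms_le {H : HeegaardDiagram g S} [Finite H.generators]
    {w : Fin g → List (Fin g × ℤˣ × Circle)} (hnd : ∀ j, ((w j).map fun l => l.2.2).Nodup)
    (hw : ∀ j, ∀ l ∈ w j, H.β j l.2.2 ∈ range (H.α l.1)) (hinj : ∀ j, Function.Injective (H.β j))
    (hd : Pairwise fun i j => Disjoint (range (H.β i)) (range (H.β j))) :
    Nat.card {κ : ∀ j, Fin (w j).length // Function.Injective fun j => ((w j).get (κ j)).1} ≤
      Nat.card H.generators := by
  let σ (κ : {κ : ∀ j, Fin (w j).length // Function.Injective fun j => ((w j).get (κ j)).1}) :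
      Equiv.Perm (Fin g) := Equiv.ofBijective _ (Finite.injective_iff_bijective.1 κ.2)
  have hσ : ∀ κ i, ((w ((σ κ).symm i)).get (κ.1 ((σ κ).symm i))).1 = i := fun κ i =>
    (σ κ).apply_symm_apply i
  -- Terms are indexed by the β curves and generators by the α curves, hence the inverse
  -- permutation. Disjointness of the β curves recovers the permutation, and injectivity on each
  -- curve recovers the letters.
  let F (κ : {κ : ∀ j, Fin (w j).length // Function.Injective fun j => ((w j).get (κ j)).1}) :
      H.generators :=
    ⟨fun i => H.β ((σ κ).symm i) ((w ((σ κ).symm i)).get (κ.1 ((σ κ).symm i))).2.2, (σ κ).symm,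
      fun i => ⟨by
        have := hw ((σ κ).symm i) _ (List.get_mem _ (κ.1 ((σ κ).symm i)))
        rwa [hσ] at this, _, rfl⟩⟩
  refine Nat.card_le_card_of_injective F fun κ κ' h => ?_
  have h1 : ∀ i, H.β ((σ κ).symm i) ((w ((σ κ).symm i)).get (κ.1 ((σ κ).symm i))).2.2 =
      H.β ((σ κ').symm i) ((w ((σ κ').symm i)).get (κ'.1 ((σ κ').symm i))).2.2 := fun i =>
    congrFun (congrArg Subtype.val h) i
  have h2 : ∀ i, (σ κ).symm i = (σ κ').symm i := by
    intro i
    by_contra hne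
    exact disjoint_left.1 (hd hne) ⟨_, rfl⟩ ⟨_, (h1 i).symm⟩
  apply Subtype.ext
  funext j
  obtain ⟨i, rfl⟩ := (σ κ).symm.surjective j
  have h3 := h1 i
  rw [← h2 i] at h3
  have h4 := hinj _ h3
  have h5 := hnd ((σ κ).symm i)
  apply Fin.ext
  refine (h5.getElem_inj_iff (hi := by simp) (hj := by simp)).1 ?_
  simpa using h4

end HeegaardDiagram

end

theorem theorem4p1 {Y : Type u} [TopologicalSpace Y] [T2Space Y] [CompactSpace Y]
    [ConnectedSpace Y] [ChartedSpace (EuclideanSpace ℝ (Fin 3)) Y]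
    (hY : IsStrongLSpace Y) (y : Y) :
    ¬ LeftOrderable (FundamentalGroup Y y) := by
  obtain ⟨hfin, g, S, _, _, H, hH, ⟨e⟩⟩ := hY
  have : LocallyPathConnectedSpace Y :=
    ChartedSpace.locallyPathConnectedSpace (EuclideanSpace ℝ (Fin 3)) Y
  have : PathConnectedSpace Y := pathConnectedSpace_iff_connectedSpace.2 inferInstance
  obtain ⟨hgen, hcard⟩ := finite_and_card_of_finsupp_equiv e
  obtain ⟨T, w, hw, hnd, hmem, hinj, hd⟩ := hH.exists_splitting
  exact hw.not_leftOrderable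
    (ChartedSpace.semilocallySimplyConnected (EuclideanSpace ℝ (Fin 3)) Y) y
    ((HeegaardDiagram.card_terms_le hnd hmem hinj hd).trans hcard.le)
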